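/- **Setting.** Let $\mathcal G=(\mathcal S,\mathcal N,\{\mathcal A_i,R_i\}_{i\in\mathcal N},P,\gamma,\rho)$ be a finite multi-agent Markov decision process: a finite nonempty set $\mathcal N$ of $n$ agents, a finite state space with $S=|\mathcal S|$, finite nonempty action sets $\mathcal A_i$ with $A_{\max}=\max_i|\mathcal A_i|$, $\mathcal A=\prod_i\mathcal A_i$, rewards $R_i:\mathcal S\times\mathcal A\to[-1,1]$, transition probabilities $P(\cdot\mid s,\mathbf a)$, discount factor $\gamma\in[0,1)$, and distribution $\rho\in\Delta(\mathcal S)$ of the initial state of the sampled trajectories. A joint policy is $\pi=(\pi_i)_i\in\Pi=\prod_i\Delta(\mathcal A_i)^{\mathcal S}$; agents randomize independently. Let $V^i_s(\pi)=\sum_{t\ge0}\gamma^t\,\mathbb E_\pi[R_i(s_t,\mathbf a_t)\mid s_0=s]$, $V^i_\nu(\pi)=\sum_s\nu(s)V^i_s(\pi)$ and $d^\pi_\nu(s)=(1-\gamma)\sum_{t\ge0}\gamma^t\Pr^\pi(s_t=s\mid s_0\sim\nu)$. Assume $\mathcal G$ is a Markov potential game: there are functions $\Phi_s:\Pi\to\mathbb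 R$ with $$\Phi_s(\pi_i,\pi_{-i})-\Phi_s(\pi_i',\pi_{-i})=V^i_s(\pi_i,\pi_{-i})-V^i_s(\pi'_i,\pi_{-i})$$ for all $i$, $s$, $\pi_i,\pi_i'$, $\pi_{-i}$. Put $\Phi_\rho=\sum_s\rho(s)\Phi_s$ and $\Phi_{\max}=\sup_\Pi\Phi_\rho-\inf_\Pi\Phi_\rho$ (the maximum of $\Phi_\rho$ when it is shifted to have minimum $0$). Let $I\subseteq\Delta(\mathcal S)$ be any nonempty set of initial distributions at which play is evaluated ($I=\{\rho\}$, or a single arbitrary initial state, or all of $\Delta(\mathcal S)$, are examples). A joint policy $\pi$ is an $\epsilon$-Nash policy (from $I$) if $V^i_\nu(\pi)\ge V^i_\nu(\pi_i',\pi_{-i})-\epsilon$ for all $i$, all $\pi'_i$ and all $\nu\in I$; for $I=\Delta(\mathcal S)$ this is the same as requiring it from every state. Let $\mathrm{gap}(\pi)$ be the least $\epsilon\ge0$ for which $\pi$ is an $\epsilon$-Nash policy. Assume that $\rho(s)=0$ implies $d^\pi_\nu(s)=0$ for all $\pi\in\Pi$, $\nu\in I$, and let $D=\sup_{\nu\in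 I,\,\pi\in\Pi}\|d^\pi_\nu/\rho\|_\infty$ be the distribution mismatch coefficient (with $0/0=0$). **Algorithm.** For $\alpha\in[0,1]$ the $\alpha$-greedy policy with parameter $x_i\in\Delta(\mathcal A_i)^{\mathcal S}$ is $\pi_{i}(a\mid s)=(1-\alpha)x_{i,s,a}+\alpha/|\mathcal A_i|$. Start from an arbitrary parameter $x^{(0)}$. At iteration $t$, with $\pi^{(t)}$ the $\alpha$-greedy joint policy of $x^{(t)}$, draw a horizon $K$ with $\Pr(K=k)=(1-\gamma)\gamma^k$, $k\ge0$, and, independently of it, a trajectory $s_0,\mathbf a_0,\dots,s_K,\mathbf a_K$ of $\pi^{(t)}$ with $s_0\sim\rho$ (fresh randomness at each iteration), and let all agents update simultaneously by $$\hat\nabla_i^{(t)}=\Big(\sum_{k=0}^KR_i(s_k,\mathbf a_k)\Big)\sum_{k=0}^K\nabla_{x_i}\log\pi^{(t)}_i(a_{i,k}\mid s_k),\qquad x_i^{(t+1)}=P_{\Delta(\mathcal A_i)^{\mathcal S}}\big(x_i^{(t)}+\eta\hat\nabla_i^{(t)}\big),$$ where $P$ is Euclidean projection. **Theorem.** Let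 $0<\epsilon\le(1-\gamma)^2/4$, $\alpha=\epsilon^2$, and $$\eta=\frac{\epsilon^4(1-\gamma)^9}{10^5\,n^2A_{\max}^3D^2S},\qquad T=\max\left\{1,\left\lceil\frac{10^8\,n^2A_{\max}^3\Phi_{\max}D^4S^2}{(1-\gamma)^{11}\,\epsilon^6}\right\rceil\right\}=O(1/\epsilon^6).$$ Then for every $x^{(0)}$ there is $t\in\{1,\dots,T\}$ such that $\pi^{(t)}$ is in expectation an $\epsilon$-Nash policy, i.e. $\mathbb E\big[\mathrm{gap}(\pi^{(t)})\big]\le\epsilon$. -/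

import Mathlib

namespace MarkovGame

noncomputable section

/-- A finite discounted multi-agent Markov decision process with agents `N`, states `S` and action
sets `A i`: rewards in `[-1, 1]`, transition probabilities, a discount factor in `[0, 1)` and a
distribution of the state at time `0`. -/
structure Game (N S : Type*) (A : N → Type*) where
  /-- `reward i s a` is the instantaneous reward of agent `i` at state `s`, action profile `a`. -/
  reward : N → S → (∀ i, A i) → ℝ
  abs_reward_le : ∀ i s a, |reward i s a| ≤ 1
  /-- `trans s a` is the law of the next state. -/
  trans : S → (∀ i, A i) → PMF S
  discount : ℝ
  discount_nonneg : 0 ≤ discount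
  discount_lt_one : discount < 1
  /-- The law of the initial state of the sampled trajectories. -/
  init : PMF S

theorem Game.hasSum_geometric {N S : Type*} {A : N → Type*} (G : Game N S A) :
    HasSum (fun k : ℕ => ENNReal.ofReal ((1 - G.discount) * G.discount ^ k)) 1 := by
  have h0 := G.discount_nonneg
  have h1 := G.discount_lt_one
  have hs : HasSum (fun k : ℕ => (1 - G.discount) * G.discount ^ k) 1 := by
    have h := (hasSum_geometric_of_lt_one h0 h1).mul_left (1 - G.discount)
    rwa [mul_inv_cancel₀ (by linarith)] at h
  have hn : ∀ k : ℕ, 0 ≤ (1 - G.discount) * G.discount ^ k := fun k =>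
    mul_nonneg (by linarith) (pow_nonneg h0 k)
  have h := ENNReal.ofReal_tsum_of_nonneg hn hs.summable
  rw [hs.tsum_eq, ENNReal.ofReal_one] at h
  rw [h]
  exact ENNReal.summable.hasSum

/-- The geometric law of the time horizon: the play continues after each step with probability
`discount`. -/
def Game.horizonLaw {N S : Type*} {A : N → Type*} (G : Game N S A) : PMF ℕ :=
  ⟨fun k => ENNReal.ofReal ((1 - G.discount) * G.discount ^ k), G.hasSum_geometric⟩

/-- `Δ(B)^S`, as a subset of the Euclidean space `ℝ^(S × B)`. -/
def policySet (S B : Type*) [Fintype B] : Set (EuclideanSpace ℝ (S × B)) :=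
  {x | (∀ s b, 0 ≤ x (s, b)) ∧ ∀ s, ∑ b, x (s, b) = 1}

/-- Stationary randomized policies of an agent with action set `B`. -/
abbrev Policy (S B : Type*) [Fintype B] : Type _ := {x // x ∈ policySet S B}

theorem policySet_nonempty (S B : Type*) [Fintype B] [Nonempty B] : (policySet S B).Nonempty := by
  classical
  obtain ⟨b₀⟩ := ‹Nonempty B›
  refine ⟨WithLp.toLp 2 fun z => if z.2 = b₀ then 1 else 0, fun s b => ?_, fun s => ?_⟩
  · dsimp only
    split_ifs <;> norm_num
  · simp

theorem isClosed_policySet (S B : Type*) [Fintype B] : IsClosed (policySet S B) := by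
  have h : policySet S B = (⋂ s, ⋂ b, {x | 0 ≤ x (s, b)}) ∩ ⋂ s, {x | ∑ b, x (s, b) = 1} := by
    ext x
    simp [policySet]
  rw [h]
  refine IsClosed.inter (isClosed_iInter fun s => isClosed_iInter fun b => ?_)
    (isClosed_iInter fun s => ?_)
  · exact isClosed_le continuous_const (by fun_prop)
  · exact isClosed_eq (by fun_prop) continuous_const

theorem exists_closest_policy {S B : Type*} [Fintype S] [Fintype B] [Nonempty B]
    (v : EuclideanSpace ℝ (S × B)) :
    ∃ x : Policy S B, ∀ y : Policy S B, ‖v - x.1‖ ≤ ‖v - y.1‖ := by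
  obtain ⟨x, hx, hd⟩ :=
    (isClosed_policySet S B).exists_infDist_eq_dist (policySet_nonempty S B) v
  refine ⟨⟨x, hx⟩, fun y => ?_⟩
  rw [← dist_eq_norm, ← dist_eq_norm, ← hd]
  exact Metric.infDist_le_dist_of_mem y.2

/-- Euclidean projection onto `Δ(B)^S`. -/
def proj {S B : Type*} [Fintype S] [Fintype B] [Nonempty B] (v : EuclideanSpace ℝ (S × B)) :
    Policy S B :=
  (exists_closest_policy v).choose

/-- The `α`-greedy policy `(1 - α) x + α / |B|` with parameter `x`. -/
def greedy {S B : Type*} [Fintype B] [Nonempty B] (α : ℝ) (hα : α ∈ Set.Icc (0 : ℝ) 1)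
    (x : Policy S B) : Policy S B :=
  ⟨WithLp.toLp 2 fun z => (1 - α) * x.1 z + α / Fintype.card B, by
    have hc : (0 : ℝ) < Fintype.card B := by exact_mod_cast Fintype.card_pos
    refine ⟨fun s b => ?_, fun s => ?_⟩
    · exact add_nonneg (mul_nonneg (by linarith [hα.2]) (x.2.1 s b)) (div_nonneg hα.1 hc.le)
    · simp only [Finset.sum_add_distrib, ← Finset.mul_sum, x.2.2 s, Finset.sum_const,
        Finset.card_univ, nsmul_eq_mul]
      field_simp
      ring⟩

variable {N S : Type*} {A : N → Type*} [Fintype N] [DecidableEq N] [Fintype S]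
  [∀ i, Fintype (A i)]

/-- A joint policy: one policy per agent; the agents randomize independently. -/
abbrev JointPolicy (N S : Type*) (A : N → Type*) [∀ i, Fintype (A i)] : Type _ :=
  ∀ i : N, Policy S (A i)

/-- The law of the action profile drawn at state `s`: the product of the agents' policies. -/
def actionLaw (π : JointPolicy N S A) (s : S) : PMF (∀ i, A i) :=
  PMF.ofFintype (fun a => ∏ i, ENNReal.ofReal ((π i).1 (s, a i))) (by
    rw [← Fintype.prod_sum fun i (b : A i) => ENNReal.ofReal ((π i).1 (s, b))]
    refine Finset.prod_eq_one fun i _ => ?_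
    rw [← ENNReal.ofReal_sum_of_nonneg fun b _ => (π i).2.1 s b, (π i).2.2 s, ENNReal.ofReal_one])

namespace Game

variable (G : Game N S A)

/-- The law of the state at time `t` when the initial state has law `ν` and `π` is played. -/
def stateLaw (π : JointPolicy N S A) (ν : PMF S) : ℕ → PMF S
  | 0 => ν
  | t + 1 => (stateLaw π ν t).bind fun s => (actionLaw π s).bind (G.trans s)

/-- The expected reward of agent `i` at time `t`. -/
def expReward (i : N) (π : JointPolicy N S A) (ν : PMF S) (t : ℕ) : ℝ :=
  ∑ s, (G.stateLaw π ν t s).toReal * ∑ a, (actionLaw π s a).toReal * G.reward i s a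

/-- The value `V_s^i(π)`: the expected discounted reward of agent `i` from the state `s`. -/
def stateValue (i : N) (s : S) (π : JointPolicy N S A) : ℝ :=
  ∑' t : ℕ, G.discount ^ t * G.expReward i π (PMF.pure s) t

/-- The value `V_ν^i(π) = E_{s ∼ ν} V_s^i(π)`. -/
def value (i : N) (ν : PMF S) (π : JointPolicy N S A) : ℝ :=
  ∑ s, (ν s).toReal * G.stateValue i s π

/-- The discounted state visitation distribution `d_ν^π`. -/
def visitation (π : JointPolicy N S A) (ν : PMF S) (s : S) : ℝ :=
  (1 - G.discount) * ∑' t : ℕ, G.discount ^ t * (G.stateLaw π ν t s).toReal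

/-- `Φ` is a potential: a unilateral change of policy of any agent changes `Φ_s` by exactly as much
as it changes that agent's value at `s`, for every state `s`. -/
def IsPotential (Φ : S → JointPolicy N S A → ℝ) : Prop :=
  ∀ (i : N) (s : S) (π : JointPolicy N S A) (p q : Policy S (A i)),
    Φ s (Function.update π i p) - Φ s (Function.update π i q) =
      G.stateValue i s (Function.update π i p) - G.stateValue i s (Function.update π i q)

/-- The oscillation of `Φ_ρ = E_{s ∼ ρ} Φ_s`, `ρ` the law of the initial state; this is the maximum
of `Φ_ρ` once `Φ` is shifted by a constant so that the minimum of `Φ_ρ` is `0`. -/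
def potentialRange (Φ : S → JointPolicy N S A → ℝ) : ℝ :=
  ⨆ z : JointPolicy N S A × JointPolicy N S A,
    (∑ s, (G.init s).toReal * Φ s z.1) - ∑ s, (G.init s).toReal * Φ s z.2

/-- The distribution mismatch coefficient: the maximum of `d_ν^π(s) / ρ(s)` over all policies,
all states and all `ν ∈ I`, where `ρ` is the law of the initial state. -/
def mismatch (I : Set (PMF S)) : ℝ :=
  ⨆ z : I × JointPolicy N S A × S, G.visitation z.2.1 z.1.1 z.2.2 / (G.init z.2.2).toReal

/-- `π` is an `ε`-Nash policy when play starts from any of the initial distributions in `I`. -/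
def IsApproxNash (I : Set (PMF S)) (ε : ℝ) (π : JointPolicy N S A) : Prop :=
  ∀ (i : N) (p : Policy S (A i)), ∀ ν ∈ I,
    G.value i ν (Function.update π i p) - ε ≤ G.value i ν π

/-- The least `ε ≥ 0` for which `π` is an `ε`-Nash policy. -/
def nashGap (I : Set (PMF S)) (π : JointPolicy N S A) : ℝ :=
  sInf {ε | 0 ≤ ε ∧ G.IsApproxNash I ε π}

/-- The law of `(s_0, a_0), …, (s_k, a_k)` when `s_0 = s` and `π` is played. -/
def pathLaw (π : JointPolicy N S A) : ℕ → S → PMF (List (S × ∀ i, A i))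
  | 0, s => (actionLaw π s).map fun a => [(s, a)]
  | k + 1, s => (actionLaw π s).bind fun a => (G.trans s a).bind fun s' =>
      (pathLaw π k s').map fun l => (s, a) :: l

/-- The law of a sampled trajectory: geometric horizon, and initial state with law `G.init`. -/
def trajectoryLaw (π : JointPolicy N S A) : PMF (List (S × ∀ i, A i)) :=
  G.horizonLaw.bind fun k => G.init.bind fun s => G.pathLaw π k s

/-- The gradient estimate of agent `i` from a trajectory: its total reward times the sum of the
gradients of `log π_i(a | s)` along the trajectory, where `π_i` is the `α`-greedy policy and the
gradient is in the parameter `x` of that policy. -/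
def gradEstimate (α : ℝ) (i : N) (x : Policy S (A i)) (l : List (S × ∀ i, A i)) :
    EuclideanSpace ℝ (S × A i) :=
  (l.map fun z => G.reward i z.1 z.2).sum •
    (l.map fun z => gradient (fun y : EuclideanSpace ℝ (S × A i) =>
      Real.log ((1 - α) * y (z.1, z.2 i) + α / Fintype.card (A i))) x.1).sum

/-- One simultaneous step of projected stochastic gradient ascent with step-size `η`. -/
def step [∀ i, Nonempty (A i)] (α η : ℝ) (x : JointPolicy N S A) (l : List (S × ∀ i, A i)) :
    JointPolicy N S A :=
  fun i => proj ((x i).1 + η • G.gradEstimate α i (x i) l)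

/-- The law of the parameter after `t` steps of independent projected stochastic gradient ascent
from `x₀`; every step uses a fresh trajectory of the current `α`-greedy joint policy. -/
def iterateLaw [∀ i, Nonempty (A i)] (α : ℝ) (hα : α ∈ Set.Icc (0 : ℝ) 1) (η : ℝ)
    (x₀ : JointPolicy N S A) : ℕ → PMF (JointPolicy N S A)
  | 0 => PMF.pure x₀
  | t + 1 => (iterateLaw α hα η x₀ t).bind fun x =>
      (G.trajectoryLaw fun i => greedy α hα (x i)).map (G.step α η x)

end Game

/-- The largest number of actions of an agent. -/
def maxActions (N : Type*) (A : N → Type*) [Fintype N] [∀ i, Fintype (A i)] : ℕ :=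
  Finset.univ.sup fun i : N => Fintype.card (A i)

/-- The step-size `ε⁴ (1 - γ)⁹ / (10⁵ n² A_max³ D² S)`. -/
def stepSize (ε γ D : ℝ) (n Amax S : ℕ) : ℝ :=
  ε ^ 4 * (1 - γ) ^ 9 / (10 ^ 5 * n ^ 2 * Amax ^ 3 * D ^ 2 * S)

/-- The number of iterations: `10⁸ n² A_max³ Φ_max D⁴ S² / ((1 - γ)¹¹ ε⁶)`, rounded up, and at
least one. -/
def iterations (ε γ D Φmax : ℝ) (n Amax S : ℕ) : ℕ :=
  max 1 ⌈10 ^ 8 * n ^ 2 * Amax ^ 3 * Φmax * D ^ 4 * S ^ 2 / ((1 - γ) ^ 11 * ε ^ 6)⌉₊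

end

end MarkovGame

namespace MarkovGame

noncomputable section

set_option linter.unusedSectionVars false

variable {N S : Type*} {A : N → Type*} [Fintype N] [DecidableEq N] [Fintype S]
  [∀ i, Fintype (A i)]

/-! Projected stochastic gradient steps are analysed through a Moreau envelope of the potential.
Write F(x) for the potential, averaged over the initial law, of the `α`-greedy joint policy with
parameter x. Although gradients are taken agent by agent, F is β-smooth: changing the agents'
policies one after another turns each increment of the potential into an increment of one agent's
value, which performance differences compare with the policy gradient at the starting point, up to a
quadratic error (`IsPotential.abs_meanPotential_sub_sub_le`). No regularity of the potential is
assumed; its continuity and boundedness also come from this estimate.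

Let Z x maximise F(y) - β‖y - x‖². Comparing the envelope at the next iterate with the competitor Z
x, and using that projection brings the iterate no farther from Z x, gives an expected decrease of
2β²η‖Z x - x‖² up to an error of order η² (`tsum_step_add_le`). This needs an estimator that is
unbiased along differences of policies (`hasSum_startExp_inner`) with finite second moment
(`exists_hasSum_startExp_norm_sq`). The score has mean zero at each state, so past rewards drop out,
and under the geometric horizon the undiscounted future reward averages to the discounted action
value. Exploration `α` bounds the inverse probabilities in the second moment.

Telescoping yields an iterate with small expected ‖Z x - x‖². Small displacement means a small Nash
gap (`nashGap_greedy_le_of_proximal`): Z x is first-order optimal up to a multiple of the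
displacement, gradient domination with the mismatch coefficient turns this into a bound on every
greedy deviation, and Lipschitz estimates pay for passing from Z x to x and from greedy to arbitrary
deviations. The constants are balanced in `stepSize_bound`. -/

/-! ### Product policies and their distance in total variation. -/

/-- The probability that the action profile `a` is drawn at state `s`. -/
def profileProb (π : JointPolicy N S A) (s : S) (a : ∀ i, A i) : ℝ := ∏ i, (π i).1 (s, a i)

theorem profileProb_nonneg (π : JointPolicy N S A) (s : S) (a : ∀ i, A i) :
    0 ≤ profileProb π s a :=
  Finset.prod_nonneg fun i _ => (π i).2.1 s (a i)

theorem sum_profileProb (π : JointPolicy N S A) (s : S) : ∑ a, profileProb π s a = 1 := by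
  unfold profileProb
  rw [← Fintype.prod_sum fun i (b : A i) => (π i).1 (s, b)]
  exact Finset.prod_eq_one fun i _ => (π i).2.2 s

theorem toReal_actionLaw (π : JointPolicy N S A) (s : S) (a : ∀ i, A i) :
    (actionLaw π s a).toReal = profileProb π s a := by
  simp only [actionLaw, PMF.ofFintype_apply, profileProb, ENNReal.toReal_prod]
  exact Finset.prod_congr rfl fun i _ => ENNReal.toReal_ofReal ((π i).2.1 _ _)

/-- Hybrid argument: replace the factors `g` by `f` one at a time. Each replacement changes a single
factor, and summing over profiles factorises into that factor's L¹ change times the L¹ masses of the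
others. -/
theorem sum_abs_prod_sub_prod_le (f g : ∀ i, A i → ℝ) (c : N → ℝ)
    (hf : ∀ i, ∑ b, |f i b| ≤ c i) (hg : ∀ i, ∑ b, |g i b| ≤ c i) :
    ∑ a : ∀ i, A i, |∏ i, f i (a i) - ∏ i, g i (a i)| ≤
      ∑ j, (∏ i ∈ Finset.univ.erase j, c i) * ∑ b, |f j b - g j b| := by
  have key : ∀ T : Finset N,
      ∑ a : ∀ i, A i, |∏ i, (if i ∈ T then f i (a i) else g i (a i)) - ∏ i, g i (a i)| ≤
      ∑ j ∈ T, (∏ i ∈ Finset.univ.erase j, c i) * ∑ b, |f j b - g j b| := by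
    intro T
    induction T using Finset.induction_on with
    | empty => simp
    | insert j T hj ih =>
      rw [Finset.sum_insert hj]
      set h : ∀ i, A i → ℝ := fun i b => if i ∈ T then f i b else g i b with hh
      have hc : ∀ i, ∑ b, |h i b| ≤ c i := fun i => by
        by_cases hi : i ∈ T
        · simpa [hh, hi] using hf i
        · simpa [hh, hi] using hg i
      have step : ∑ a : ∀ i, A i, |∏ i, (if i ∈ insert j T then f i (a i) else g i (a i)) -
          ∏ i, h i (a i)| ≤ (∏ i ∈ Finset.univ.erase j, c i) * ∑ b, |f j b - g j b| := by
        have e : ∀ a : ∀ i, A i, |∏ i, (if i ∈ insert j T then f i (a i) else g i (a i)) -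
            ∏ i, h i (a i)| = ∏ i, (if i = j then |f i (a i) - g i (a i)| else |h i (a i)|) := by
          intro a
          rw [← Finset.mul_prod_erase _ _ (Finset.mem_univ j),
            ← Finset.mul_prod_erase _ (fun i => h i (a i)) (Finset.mem_univ j),
            ← Finset.mul_prod_erase _ (fun i => if i = j then _ else _) (Finset.mem_univ j)]
          have e1 : ∏ i ∈ Finset.univ.erase j, (if i ∈ insert j T then f i (a i) else g i (a i))
              = ∏ i ∈ Finset.univ.erase j, h i (a i) := by
            refine Finset.prod_congr rfl fun i hi => ?_
            have : i ≠ j := Finset.ne_of_mem_erase hi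
            simp [hh, this]
          have e2 : ∏ i ∈ Finset.univ.erase j,
              (if i = j then |f i (a i) - g i (a i)| else |h i (a i)|)
              = ∏ i ∈ Finset.univ.erase j, |h i (a i)| := by
            refine Finset.prod_congr rfl fun i hi => ?_
            have : i ≠ j := Finset.ne_of_mem_erase hi
            simp [this]
          rw [e1, e2, ← Finset.abs_prod, ← sub_mul, abs_mul]
          simp [hh, hj]
        simp_rw [e]
        rw [← Fintype.prod_sum fun i (b : A i) => if i = j then |f i b - g i b| else |h i b|,
          ← Finset.mul_prod_erase _ _ (Finset.mem_univ j), mul_comm]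
        simp only [if_true]
        refine mul_le_mul_of_nonneg_right ?_ (Finset.sum_nonneg fun _ _ => abs_nonneg _)
        refine Finset.prod_le_prod (fun i _ => Finset.sum_nonneg fun _ _ => ?_) fun i hi => ?_
        · split_ifs <;> exact abs_nonneg _
        · simpa [Finset.ne_of_mem_erase hi] using hc i
      refine le_trans ?_ (add_le_add step ih)
      rw [← Finset.sum_add_distrib]
      exact Finset.sum_le_sum fun a _ => abs_sub_le _ _ _
  simpa using key Finset.univ

theorem sum_abs_profileProb_sub_le (π π' : JointPolicy N S A) (s : S) :
    ∑ a, |profileProb π s a - profileProb π' s a| ≤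
      ∑ j, ∑ b, |(π j).1 (s, b) - (π' j).1 (s, b)| := by
  have h1 : ∀ π : JointPolicy N S A, ∀ i, ∑ b, |(π i).1 (s, b)| ≤ (fun _ => (1 : ℝ)) i := by
    intro π i
    simp only [abs_of_nonneg ((π i).2.1 s _), (π i).2.2 s, le_refl]
  refine (sum_abs_prod_sub_prod_le (fun i b => (π i).1 (s, b)) (fun i b => (π' i).1 (s, b))
    (fun _ => 1) (h1 π) (h1 π')).trans_eq ?_
  simp

/-- Profile weights when agent `k` uses the signed weights `v` and the others follow `π`. -/
def deviationWeight (π : JointPolicy N S A) (k : N) (v : EuclideanSpace ℝ (S × A k)) (s : S)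
    (a : ∀ i, A i) : ℝ :=
  v (s, a k) * ∏ j ∈ Finset.univ.erase k, (π j).1 (s, a j)

theorem profileProb_update (π : JointPolicy N S A) (k : N) (q : Policy S (A k)) (s : S)
    (a : ∀ i, A i) :
    profileProb (Function.update π k q) s a = deviationWeight π k q.1 s a := by
  unfold profileProb deviationWeight
  rw [← Finset.mul_prod_erase _ _ (Finset.mem_univ k), Function.update_self]
  congr 1
  refine Finset.prod_congr rfl fun j hj => ?_
  rw [Function.update_of_ne (Finset.ne_of_mem_erase hj)]

theorem profileProb_eq_deviationWeight (π : JointPolicy N S A) (k : N) (s : S) (a : ∀ i, A i) :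
    profileProb π s a = deviationWeight π k (π k).1 s a := by
  rw [← profileProb_update, Function.update_eq_self]

theorem deviationWeight_sub (π : JointPolicy N S A) (k : N) (v w : EuclideanSpace ℝ (S × A k))
    (s : S) (a : ∀ i, A i) :
    deviationWeight π k (v - w) s a = deviationWeight π k v s a - deviationWeight π k w s a := by
  simp [deviationWeight, sub_mul]

theorem deviationWeight_smul (π : JointPolicy N S A) (k : N) (t : ℝ)
    (v : EuclideanSpace ℝ (S × A k)) (s : S) (a : ∀ i, A i) :
    deviationWeight π k (t • v) s a = t * deviationWeight π k v s a := by
  simp [deviationWeight, mul_assoc]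

/-- The factor of agent `k` is the same signed vector on both sides, so only the other agents
contribute to the hybrid sum, each with the mass of `v` as a prefactor. -/
theorem sum_abs_deviationWeight_sub_le (π π' : JointPolicy N S A) (k : N)
    (v : EuclideanSpace ℝ (S × A k)) (s : S) :
    ∑ a, |deviationWeight π k v s a - deviationWeight π' k v s a| ≤
      (∑ b, |v (s, b)|) * ∑ j, ∑ b, |(π j).1 (s, b) - (π' j).1 (s, b)| := by
  set F : JointPolicy N S A → ∀ i, A i → ℝ := fun π i b =>
    Function.update (fun i b => (π i).1 (s, b)) k (fun b => v (s, b)) i b with hF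
  have e : ∀ π a, deviationWeight π k v s a = ∏ i, F π i (a i) := by
    intro π a
    unfold deviationWeight
    rw [← Finset.mul_prod_erase _ _ (Finset.mem_univ k)]
    simp only [hF, Function.update_self]
    congr 1
    refine Finset.prod_congr rfl fun j hj => ?_
    rw [Function.update_of_ne (Finset.ne_of_mem_erase hj)]
  have h1 : ∀ π : JointPolicy N S A, ∀ i, ∑ b, |F π i b| ≤
      Function.update (fun _ => (1 : ℝ)) k (∑ b, |v (s, b)|) i := by
    intro π i
    by_cases hi : i = k
    · subst hi
      simp [hF]
    · simp only [hF, Function.update_of_ne hi]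
      simp only [abs_of_nonneg ((π i).2.1 s _), (π i).2.2 s, le_refl]
  simp_rw [e]
  refine (sum_abs_prod_sub_prod_le _ _ _ (h1 π) (h1 π')).trans ?_
  rw [Finset.mul_sum]
  refine Finset.sum_le_sum fun j _ => ?_
  by_cases hj : j = k
  · subst hj
    simp only [hF, Function.update_self, sub_self, abs_zero, Finset.sum_const_zero, mul_zero]
    exact mul_nonneg (Finset.sum_nonneg fun _ _ => abs_nonneg _)
      (Finset.sum_nonneg fun _ _ => abs_nonneg _)
  · rw [← Finset.mul_prod_erase _ _ (Finset.mem_erase.2 ⟨fun h => hj h.symm, Finset.mem_univ k⟩),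
      Finset.prod_congr rfl (g := fun _ => (1 : ℝ))
        (fun i hi => Function.update_of_ne (Finset.ne_of_mem_erase hi) _ _)]
    simp [hF, Function.update_of_ne hj]

theorem sum_abs_deviationWeight (π : JointPolicy N S A) (k : N)
    (v : EuclideanSpace ℝ (S × A k)) (s : S) :
    ∑ a, |deviationWeight π k v s a| = ∑ b, |v (s, b)| := by
  have e : ∀ a, |deviationWeight π k v s a| =
      ∏ i, Function.update (fun i b => (π i).1 (s, b)) k (fun b => |v (s, b)|) i (a i) := by
    intro a
    unfold deviationWeight
    rw [← Finset.mul_prod_erase _ _ (Finset.mem_univ k), abs_mul, Function.update_self,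
      abs_of_nonneg (Finset.prod_nonneg fun j _ => (π j).2.1 s _)]
    congr 1
    refine Finset.prod_congr rfl fun j hj => ?_
    rw [Function.update_of_ne (Finset.ne_of_mem_erase hj)]
  simp_rw [e]
  rw [← Fintype.prod_sum fun i (b : A i) =>
      Function.update (fun i b => (π i).1 (s, b)) k (fun b => |v (s, b)|) i b,
    ← Finset.mul_prod_erase _ _ (Finset.mem_univ k), Finset.prod_eq_one]
  · simp
  · intro i hi
    rw [Function.update_of_ne (Finset.ne_of_mem_erase hi)]
    exact (π i).2.2 s

theorem sum_toReal_pmf (p : PMF S) : ∑ s, (p s).toReal = 1 := by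
  rw [← ENNReal.toReal_sum fun s _ => p.apply_ne_top s, ← tsum_fintype (L := .unconditional S),
    p.tsum_coe, ENNReal.toReal_one]

theorem toReal_bind {B C : Type*} [Fintype B] (p : PMF B) (q : B → PMF C) (c : C) :
    (p.bind q c).toReal = ∑ b, (p b).toReal * (q b c).toReal := by
  rw [PMF.bind_apply, tsum_fintype, ENNReal.toReal_sum fun b _ =>
    ENNReal.mul_ne_top (p.apply_ne_top b) ((q b).apply_ne_top c)]
  simp_rw [ENNReal.toReal_mul]

theorem abs_weighted_sum_le {B : Type*} [Fintype B] (w u : B → ℝ) (c M : ℝ)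
    (hw : ∑ b, |w b| ≤ c) (hM : 0 ≤ M) (hu : ∀ b, |u b| ≤ M) : |∑ b, w b * u b| ≤ c * M := by
  refine (Finset.abs_sum_le_sum_abs _ _).trans ?_
  refine (Finset.sum_le_sum (g := fun b => |w b| * M) fun b _ => ?_).trans ?_
  · rw [abs_mul]
    exact mul_le_mul_of_nonneg_left (hu b) (abs_nonneg _)
  · rw [← Finset.sum_mul]
    exact mul_le_mul_of_nonneg_right hw hM

/-! ### Visitation measures, Bellman equations and performance differences. -/

namespace Game

variable (G : Game N S A)

theorem one_sub_discount_pos : 0 < 1 - G.discount := by linarith [G.discount_lt_one]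

/-- The expectation of `u` at the next state. -/
def nextExp (u : S → ℝ) (s : S) (a : ∀ i, A i) : ℝ := ∑ s', (G.trans s a s').toReal * u s'

/-- The expectation of `u` at the next state when `π` is played. -/
def policyNext (π : JointPolicy N S A) (u : S → ℝ) (s : S) : ℝ :=
  ∑ a, profileProb π s a * G.nextExp u s a

theorem abs_nextExp_le (u : S → ℝ) (M : ℝ) (hM : 0 ≤ M) (hu : ∀ s, |u s| ≤ M) (s : S)
    (a : ∀ i, A i) : |G.nextExp u s a| ≤ M := by
  have := abs_weighted_sum_le (fun s' => (G.trans s a s').toReal) u 1 M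
    (by simp only [ENNReal.abs_toReal, sum_toReal_pmf, le_refl]) hM hu
  simpa [nextExp] using this

theorem nextExp_const (c : ℝ) (s : S) (a : ∀ i, A i) : G.nextExp (fun _ => c) s a = c := by
  simp [nextExp, ← Finset.sum_mul, sum_toReal_pmf]

theorem nextExp_sub (u v : S → ℝ) (s : S) (a : ∀ i, A i) :
    G.nextExp (fun s => u s - v s) s a = G.nextExp u s a - G.nextExp v s a := by
  simp [nextExp, mul_sub, Finset.sum_sub_distrib]

theorem policyNext_const (π : JointPolicy N S A) (c : ℝ) (s : S) :
    G.policyNext π (fun _ => c) s = c := by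
  simp [policyNext, nextExp_const, ← Finset.sum_mul, sum_profileProb]

theorem policyNext_sub (π : JointPolicy N S A) (u v : S → ℝ) (s : S) :
    G.policyNext π (fun s => u s - v s) s = G.policyNext π u s - G.policyNext π v s := by
  simp [policyNext, nextExp_sub, mul_sub, Finset.sum_sub_distrib]

theorem abs_policy_sum_le (π : JointPolicy N S A) (s : S) (h : (∀ i, A i) → ℝ) (M : ℝ)
    (hM : 0 ≤ M) (hh : ∀ a, |h a| ≤ M) : |∑ a, profileProb π s a * h a| ≤ M := by
  have := abs_weighted_sum_le (profileProb π s) h 1 M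
    (by simp only [abs_of_nonneg (profileProb_nonneg π s _), sum_profileProb, le_refl]) hM hh
  simpa using this

theorem sum_stateLaw_succ (π : JointPolicy N S A) (ν : PMF S) (t : ℕ) (u : S → ℝ) :
    ∑ s, (G.stateLaw π ν (t + 1) s).toReal * u s =
      ∑ s, (G.stateLaw π ν t s).toReal * G.policyNext π u s := by
  simp only [stateLaw, toReal_bind, toReal_actionLaw, policyNext, nextExp, Finset.sum_mul,
    Finset.mul_sum]
  rw [Finset.sum_comm]
  refine Finset.sum_congr rfl fun s _ => ?_
  rw [Finset.sum_comm]
  refine Finset.sum_congr rfl fun a _ => Finset.sum_congr rfl fun s' _ => ?_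
  ring

theorem toReal_stateLaw_le_one (π : JointPolicy N S A) (ν : PMF S) (t : ℕ) (s : S) :
    (G.stateLaw π ν t s).toReal ≤ 1 :=
  ENNReal.toReal_le_of_le_ofReal zero_le_one (by simpa using PMF.coe_le_one _ s)

theorem summable_visitation (π : JointPolicy N S A) (ν : PMF S) (s : S) :
    Summable fun t : ℕ => G.discount ^ t * (G.stateLaw π ν t s).toReal :=
  Summable.of_nonneg_of_le
    (fun t => mul_nonneg (pow_nonneg G.discount_nonneg t) ENNReal.toReal_nonneg)
    (fun t => mul_le_of_le_one_right (pow_nonneg G.discount_nonneg t)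
      (G.toReal_stateLaw_le_one π ν t s))
    (summable_geometric_of_lt_one G.discount_nonneg G.discount_lt_one)

theorem visitation_nonneg (π : JointPolicy N S A) (ν : PMF S) (s : S) :
    0 ≤ G.visitation π ν s :=
  mul_nonneg G.one_sub_discount_pos.le (tsum_nonneg fun t =>
    mul_nonneg (pow_nonneg G.discount_nonneg t) ENNReal.toReal_nonneg)

theorem le_visitation (π : JointPolicy N S A) (ν : PMF S) (s : S) :
    (1 - G.discount) * (ν s).toReal ≤ G.visitation π ν s := by
  refine mul_le_mul_of_nonneg_left ?_ G.one_sub_discount_pos.le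
  have := (G.summable_visitation π ν s).le_tsum 0 fun t _ =>
    mul_nonneg (pow_nonneg G.discount_nonneg t) ENNReal.toReal_nonneg
  simpa [stateLaw] using this

theorem hasSum_visitation (π : JointPolicy N S A) (ν : PMF S) (u : S → ℝ) :
    HasSum (fun t : ℕ => G.discount ^ t * ∑ s, (G.stateLaw π ν t s).toReal * u s)
      ((1 - G.discount)⁻¹ * ∑ s, G.visitation π ν s * u s) := by
  have h : HasSum (fun t : ℕ => ∑ s, G.discount ^ t * (G.stateLaw π ν t s).toReal * u s)
      (∑ s, (∑' t : ℕ, G.discount ^ t * (G.stateLaw π ν t s).toReal) * u s) :=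
    hasSum_sum fun s _ => (G.summable_visitation π ν s).hasSum.mul_right (u s)
  have h0 := G.one_sub_discount_pos.ne'
  convert h using 1
  · funext t
    rw [Finset.mul_sum]
    exact Finset.sum_congr rfl fun s _ => by ring
  · rw [Finset.mul_sum]
    refine Finset.sum_congr rfl fun s _ => ?_
    rw [visitation]
    field_simp

/-- Flow balance of the visitation measure, d = (1 - γ)ν + γ dP, tested against `u`: shifting the
time index by one isolates the initial term. Existence, uniqueness and bounds for Bellman equations
all rest on it. -/
theorem sum_visitation_sub (π : JointPolicy N S A) (ν : PMF S) (u : S → ℝ) :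
    ∑ s, G.visitation π ν s * (u s - G.discount * G.policyNext π u s) =
      (1 - G.discount) * ∑ s, (ν s).toReal * u s := by
  have h1 := G.hasSum_visitation π ν u
  have h2 := (G.hasSum_visitation π ν (G.policyNext π u)).mul_left G.discount
  have h3 := (hasSum_nat_add_iff' 1).2 h1
  have e : (fun t : ℕ => G.discount ^ (t + 1) * ∑ s, (G.stateLaw π ν (t + 1) s).toReal * u s) =
      fun t : ℕ => G.discount * (G.discount ^ t *
        ∑ s, (G.stateLaw π ν t s).toReal * G.policyNext π u s) := by
    funext t
    rw [G.sum_stateLaw_succ, pow_succ]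
    ring
  rw [e] at h3
  have h4 := h3.unique h2
  have h0 := G.one_sub_discount_pos.ne'
  simp only [Finset.range_one, Finset.sum_singleton, pow_zero, one_mul, stateLaw] at h4
  have h5 : ∑ s, G.visitation π ν s * (u s - G.discount * G.policyNext π u s) =
      ∑ s, G.visitation π ν s * u s -
        G.discount * ∑ s, G.visitation π ν s * G.policyNext π u s := by
    rw [Finset.mul_sum, ← Finset.sum_sub_distrib]
    exact Finset.sum_congr rfl fun s _ => by ring
  rw [h5]
  field_simp at h4
  linarith

theorem sum_visitation (π : JointPolicy N S A) (ν : PMF S) :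
    ∑ s, G.visitation π ν s = 1 := by
  have h := G.sum_visitation_sub π ν fun _ => 1
  simp only [policyNext_const, mul_one, sum_toReal_pmf, ← Finset.sum_mul] at h
  exact mul_right_cancel₀ G.one_sub_discount_pos.ne' (by rw [h, one_mul])

theorem abs_sum_visitation_le (π : JointPolicy N S A) (ν : PMF S) (u : S → ℝ) (M : ℝ)
    (hM : 0 ≤ M) (hu : ∀ s, |u s| ≤ M) : |∑ s, G.visitation π ν s * u s| ≤ M := by
  have := abs_weighted_sum_le (G.visitation π ν) u 1 M
    (by simp only [abs_of_nonneg (G.visitation_nonneg π ν _), sum_visitation, le_refl]) hM hu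
  simpa using this

theorem sum_pure_toReal (s : S) (u : S → ℝ) : ∑ s', (PMF.pure s s').toReal * u s' = u s := by
  classical
  rw [Finset.sum_eq_single s]
  · simp
  · intro b _ hb
    simp [PMF.pure_apply, hb]
  · simp

/-- The operator u ↦ u - γPu is injective, by flow balance started from each single state, hence
surjective in finite dimension. -/
theorem exists_bellman (π : JointPolicy N S A) (f : S → ℝ) :
    ∃ u : S → ℝ, ∀ s, u s = f s + G.discount * G.policyNext π u s := by
  let L : (S → ℝ) →ₗ[ℝ] (S → ℝ) :=
    { toFun := fun u s => u s - G.discount * G.policyNext π u s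
      map_add' := fun u v => by
        funext s
        simp only [policyNext, nextExp, Pi.add_apply, mul_add, Finset.sum_add_distrib]
        ring
      map_smul' := fun c u => by
        funext s
        have : G.policyNext π (c • u) s = c * G.policyNext π u s := by
          simp only [policyNext, nextExp, Pi.smul_apply, smul_eq_mul, Finset.mul_sum]
          exact Finset.sum_congr rfl fun _ _ => Finset.sum_congr rfl fun _ _ => by ring
        simp only [this, Pi.smul_apply, smul_eq_mul, RingHom.id_apply]
        ring }
  have hinj : Function.Injective L := by
    rw [← LinearMap.ker_eq_bot, LinearMap.ker_eq_bot']
    intro u hu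
    funext s
    have h := G.sum_visitation_sub π (PMF.pure s) u
    rw [sum_pure_toReal] at h
    have h' : ∀ s, u s - G.discount * G.policyNext π u s = 0 := fun s => congrFun hu s
    simp only [h', mul_zero, Finset.sum_const_zero] at h
    have := G.one_sub_discount_pos.ne'
    simpa [this] using h.symm
  obtain ⟨u, hu⟩ := LinearMap.injective_iff_surjective.1 hinj f
  refine ⟨u, fun s => ?_⟩
  have : u s - G.discount * G.policyNext π u s = f s := congrFun hu s
  linarith

/-- The expected instantaneous reward of agent `i` at `s`. -/
def meanReward (i : N) (π : JointPolicy N S A) (s : S) : ℝ :=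
  ∑ a, profileProb π s a * G.reward i s a

theorem eq_stateValue_of_bellman (i : N) (π : JointPolicy N S A) (u : S → ℝ)
    (hu : ∀ s, u s = G.meanReward i π s + G.discount * G.policyNext π u s) (s : S) :
    u s = G.stateValue i s π := by
  have h := G.sum_visitation_sub π (PMF.pure s) u
  rw [sum_pure_toReal] at h
  have h1 : ∀ s, u s - G.discount * G.policyNext π u s = G.meanReward i π s := fun s => by
    linarith [hu s]
  simp only [h1] at h
  have h2 := (G.hasSum_visitation π (PMF.pure s) (G.meanReward i π)).tsum_eq
  rw [h, inv_mul_cancel_left₀ G.one_sub_discount_pos.ne'] at h2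
  rw [← h2, stateValue]
  simp only [expReward, meanReward, toReal_actionLaw]

theorem stateValue_eq (i : N) (π : JointPolicy N S A) (s : S) :
    G.stateValue i s π =
      G.meanReward i π s + G.discount * G.policyNext π (fun s => G.stateValue i s π) s := by
  obtain ⟨u, hu⟩ := G.exists_bellman π (G.meanReward i π)
  have : u = fun s => G.stateValue i s π := funext (G.eq_stateValue_of_bellman i π u hu)
  rw [← this, ← hu s, this]

theorem value_pure (i : N) (s : S) (π : JointPolicy N S A) :
    G.value i (PMF.pure s) π = G.stateValue i s π :=
  sum_pure_toReal s _

theorem abs_meanReward_le (i : N) (π : JointPolicy N S A) (s : S) : |G.meanReward i π s| ≤ 1 :=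
  abs_policy_sum_le π s _ 1 zero_le_one (G.abs_reward_le i s)

theorem abs_le_of_bellman (π : JointPolicy N S A) (f u : S → ℝ) (M : ℝ) (hM : 0 ≤ M)
    (hf : ∀ s, |f s| ≤ M) (hu : ∀ s, u s = f s + G.discount * G.policyNext π u s) (s : S) :
    |u s| ≤ M / (1 - G.discount) := by
  have h := G.sum_visitation_sub π (PMF.pure s) u
  rw [sum_pure_toReal] at h
  have h1 : ∀ s, u s - G.discount * G.policyNext π u s = f s := fun s => by linarith [hu s]
  simp only [h1] at h
  have h2 := G.abs_sum_visitation_le π (PMF.pure s) f M hM hf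
  rw [h, abs_mul, abs_of_pos G.one_sub_discount_pos] at h2
  rw [le_div_iff₀ G.one_sub_discount_pos]
  linarith

theorem abs_stateValue_le (i : N) (π : JointPolicy N S A) (s : S) :
    |G.stateValue i s π| ≤ 1 / (1 - G.discount) :=
  G.abs_le_of_bellman π _ _ 1 zero_le_one (G.abs_meanReward_le i π) (G.stateValue_eq i π) s

/-- The action value of agent `i` at an action profile. -/
def actionValue (i : N) (π : JointPolicy N S A) (s : S) (a : ∀ i, A i) : ℝ :=
  G.reward i s a + G.discount * G.nextExp (fun s => G.stateValue i s π) s a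

theorem abs_actionValue_le (i : N) (π : JointPolicy N S A) (s : S) (a : ∀ i, A i) :
    |G.actionValue i π s a| ≤ 1 / (1 - G.discount) := by
  have h1 := G.abs_reward_le i s a
  have h2 := G.abs_nextExp_le (fun s => G.stateValue i s π) _
    (one_div_nonneg.2 G.one_sub_discount_pos.le) (G.abs_stateValue_le i π) s a
  refine (abs_add_le _ _).trans ?_
  rw [abs_mul, abs_of_nonneg G.discount_nonneg]
  have h3 := mul_le_mul_of_nonneg_left h2 G.discount_nonneg
  have h4 : 1 + G.discount * (1 / (1 - G.discount)) = 1 / (1 - G.discount) := by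
    have := G.one_sub_discount_pos.ne'
    field_simp
    ring
  linarith

theorem sum_profileProb_actionValue (i : N) (π π' : JointPolicy N S A) (s : S) :
    ∑ a, profileProb π' s a * G.actionValue i π s a =
      G.meanReward i π' s + G.discount * G.policyNext π' (fun s => G.stateValue i s π) s := by
  simp only [actionValue, meanReward, policyNext, mul_add, Finset.sum_add_distrib, Finset.mul_sum]
  congr 1
  exact Finset.sum_congr rfl fun a _ => by ring

/-- Performance difference identity: apply flow balance under `π'` to the difference of the two
value functions and eliminate both values with their Bellman equations. -/
theorem value_sub (i : N) (ν : PMF S) (π π' : JointPolicy N S A) :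
    (1 - G.discount) * (G.value i ν π' - G.value i ν π) =
      ∑ s, G.visitation π' ν s *
        ∑ a, (profileProb π' s a - profileProb π s a) * G.actionValue i π s a := by
  have h := G.sum_visitation_sub π' ν fun s => G.stateValue i s π' - G.stateValue i s π
  have e : G.value i ν π' - G.value i ν π =
      ∑ s, (ν s).toReal * (G.stateValue i s π' - G.stateValue i s π) := by
    simp only [value, mul_sub, Finset.sum_sub_distrib]
  rw [e, ← h]
  refine Finset.sum_congr rfl fun s _ => ?_
  simp only [sub_mul, Finset.sum_sub_distrib, sum_profileProb_actionValue, policyNext_sub]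
  rw [← G.stateValue_eq i π s]
  linear_combination G.visitation π' ν s * G.stateValue_eq i π' s

theorem abs_value_sub_le (i : N) (ν : PMF S) (π π' : JointPolicy N S A) (δ : ℝ)
    (hδ : ∀ s, ∑ a, |profileProb π s a - profileProb π' s a| ≤ δ) :
    |G.value i ν π - G.value i ν π'| ≤ δ / (1 - G.discount) ^ 2 := by
  have hp := G.one_sub_discount_pos
  obtain ⟨s₀, -⟩ := ν.support_nonempty
  have hδ0 : 0 ≤ δ := (Finset.sum_nonneg fun _ _ => abs_nonneg _).trans (hδ s₀)
  have h := G.abs_sum_visitation_le π ν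
    (fun s => ∑ a, (profileProb π s a - profileProb π' s a) * G.actionValue i π' s a)
    (δ * (1 / (1 - G.discount))) (mul_nonneg hδ0 (one_div_nonneg.2 hp.le))
    fun s => abs_weighted_sum_le _ _ _ _ (hδ s) (one_div_nonneg.2 hp.le)
      (G.abs_actionValue_le i π' s)
  rw [← value_sub, abs_mul, abs_of_pos hp] at h
  rw [le_div_iff₀ (by positivity)]
  have h2 := mul_le_mul_of_nonneg_left h hp.le
  have h3 : (1 - G.discount) * (δ * (1 / (1 - G.discount))) = δ := by field_simp
  rw [h3] at h2
  linarith [h2]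

/-- Duality avoids comparing state laws time by time: solve the Bellman equation of `π'` with source
`f`. Both averages of `f` are then integrals against the visitation of `π`, and they differ only
through the one-step kernels applied to the bounded solution. -/
theorem abs_sum_visitation_sub_le (ν : PMF S) (π π' : JointPolicy N S A) (δ : ℝ)
    (hδ : ∀ s, ∑ a, |profileProb π s a - profileProb π' s a| ≤ δ) (f : S → ℝ) (M : ℝ)
    (hM : 0 ≤ M) (hf : ∀ s, |f s| ≤ M) :
    |∑ s, G.visitation π ν s * f s - ∑ s, G.visitation π' ν s * f s| ≤
      G.discount * δ * M / (1 - G.discount) := by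
  have hp := G.one_sub_discount_pos
  obtain ⟨s₀, -⟩ := ν.support_nonempty
  have hδ0 : 0 ≤ δ := (Finset.sum_nonneg fun _ _ => abs_nonneg _).trans (hδ s₀)
  obtain ⟨u, hu⟩ := G.exists_bellman π' f
  have hb := G.abs_le_of_bellman π' f u M hM hf hu
  have h1 := G.sum_visitation_sub π ν u
  have h2 := G.sum_visitation_sub π' ν u
  have e : ∑ s, G.visitation π ν s * f s - ∑ s, G.visitation π' ν s * f s =
      ∑ s, G.visitation π ν s * (G.discount *
        ∑ a, (profileProb π s a - profileProb π' s a) * G.nextExp u s a) := by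
    have e1 : ∑ s, G.visitation π' ν s * f s = ∑ s, G.visitation π ν s *
        (u s - G.discount * G.policyNext π u s) := by
      rw [h1, ← h2]
      exact Finset.sum_congr rfl fun s _ => by rw [hu s]; ring
    rw [e1, ← Finset.sum_sub_distrib]
    refine Finset.sum_congr rfl fun s _ => ?_
    simp only [sub_mul, Finset.sum_sub_distrib]
    change _ = G.visitation π ν s *
      (G.discount * (G.policyNext π u s - G.policyNext π' u s))
    linear_combination (- G.visitation π ν s) * hu s
  rw [e]
  refine G.abs_sum_visitation_le π ν _ _ (div_nonneg (mul_nonneg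
    (mul_nonneg G.discount_nonneg hδ0) hM) hp.le) fun s => ?_
  rw [abs_mul, abs_of_nonneg G.discount_nonneg, mul_assoc, mul_div_assoc, mul_div_assoc]
  exact mul_le_mul_of_nonneg_left (abs_weighted_sum_le _ _ _ _ (hδ s) (div_nonneg hM hp.le)
    (G.abs_nextExp_le u _ (div_nonneg hM hp.le) hb s)) G.discount_nonneg

end Game

/-! ### First-order expansion of values and of the potential. -/

theorem sum_abs_sub_update_le (x z : JointPolicy N S A) (k : N) (p : Policy S (A k)) (s : S) :
    ∑ j, ∑ b, |(Function.update z k p j).1 (s, b) - (Function.update x k p j).1 (s, b)| ≤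
      ∑ j, ∑ b, |(z j).1 (s, b) - (x j).1 (s, b)| := by
  refine Finset.sum_le_sum fun j _ => ?_
  by_cases h : j = k
  · subst h
    simp only [Function.update_self, sub_self, abs_zero, Finset.sum_const_zero]
    exact Finset.sum_nonneg fun _ _ => abs_nonneg _
  · simp [Function.update_of_ne h]

namespace Game

variable (G : Game N S A)

/-- The derivative of the value of agent `k` at the initial distribution, in direction `v` of the
policy of agent `k`, by the policy gradient theorem. -/
def policyGradient (k : N) (π : JointPolicy N S A) (v : EuclideanSpace ℝ (S × A k)) : ℝ :=
  (1 - G.discount)⁻¹ * ∑ s, G.visitation π G.init s *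
    ∑ a, deviationWeight π k v s a * G.actionValue k π s a

theorem policyGradient_smul (k : N) (π : JointPolicy N S A) (t : ℝ)
    (v : EuclideanSpace ℝ (S × A k)) :
    G.policyGradient k π (t • v) = t * G.policyGradient k π v := by
  simp only [policyGradient, deviationWeight_smul, Finset.mul_sum]
  exact Finset.sum_congr rfl fun s _ => Finset.sum_congr rfl fun a _ => by ring

theorem policyGradient_zero (k : N) (π : JointPolicy N S A) : G.policyGradient k π 0 = 0 := by
  simpa using G.policyGradient_smul k π 0 0

theorem value_update_sub (i k : N) (ν : PMF S) (π : JointPolicy N S A) (q : Policy S (A k)) :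
    (1 - G.discount) * (G.value i ν (Function.update π k q) - G.value i ν π) =
      ∑ s, G.visitation (Function.update π k q) ν s *
        ∑ a, deviationWeight π k (q.1 - (π k).1) s a * G.actionValue i π s a := by
  rw [value_sub]
  simp only [profileProb_update, profileProb_eq_deviationWeight π k, deviationWeight_sub]

theorem abs_actionValue_sub_le (i : N) (π π' : JointPolicy N S A) (δ : ℝ)
    (hδ : ∀ s, ∑ a, |profileProb π s a - profileProb π' s a| ≤ δ) (s : S) (a : ∀ i, A i) :
    |G.actionValue i π s a - G.actionValue i π' s a| ≤
      G.discount * (δ / (1 - G.discount) ^ 2) := by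
  have hp := G.one_sub_discount_pos
  have hδ0 : 0 ≤ δ := (Finset.sum_nonneg fun _ _ => abs_nonneg _).trans (hδ s)
  have e : G.actionValue i π s a - G.actionValue i π' s a = G.discount *
      G.nextExp (fun s => G.stateValue i s π - G.stateValue i s π') s a := by
    rw [nextExp_sub, actionValue, actionValue]
    ring
  rw [e, abs_mul, abs_of_nonneg G.discount_nonneg]
  refine mul_le_mul_of_nonneg_left (G.abs_nextExp_le _ _ (by positivity) (fun s => ?_) s a)
    G.discount_nonneg
  rw [← value_pure, ← value_pure]
  exact G.abs_value_sub_le i _ π π' δ hδ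

/-- The performance difference at `z` has the form of the policy gradient at `x`, with three
ingredients out of place: the visitation measure, the weights of the other agents and the action
values. Each is off by order `E` and is multiplied by the size `e` of the deviation, so the error is
of second order. -/
theorem abs_value_update_sub_policyGradient_le (k : N) (x z : JointPolicy N S A)
    (q : Policy S (A k)) (hk : z k = x k) (e E : ℝ)
    (he : ∀ s, ∑ b, |q.1 (s, b) - (x k).1 (s, b)| ≤ e)
    (hz : ∀ s, ∑ a, |profileProb z s a - profileProb x s a| ≤ E)
    (hw : ∀ s, ∑ j, ∑ b, |(z j).1 (s, b) - (x j).1 (s, b)| ≤ E)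
    (hz' : ∀ s, ∑ a, |profileProb (Function.update z k q) s a - profileProb x s a| ≤ E) :
    |G.value k G.init (Function.update z k q) - G.value k G.init z -
      G.policyGradient k x (q.1 - (x k).1)| ≤ 2 * e * E / (1 - G.discount) ^ 3 := by
  have hp := G.one_sub_discount_pos
  obtain ⟨s₀, -⟩ := G.init.support_nonempty
  have he0 : 0 ≤ e := (Finset.sum_nonneg fun _ _ => abs_nonneg _).trans (he s₀)
  have hE0 : 0 ≤ E := (Finset.sum_nonneg fun _ _ => abs_nonneg _).trans (hz s₀)
  set v := q.1 - (x k).1 with hv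
  have he' : ∀ s, ∑ b, |v (s, b)| ≤ e := he
  set m : JointPolicy N S A → S → ℝ := fun π s =>
    ∑ a, deviationWeight π k v s a * G.actionValue k π s a with hm
  have h1 := G.value_update_sub k k G.init z q
  rw [hk] at h1
  have h2 : (1 - G.discount) * G.policyGradient k x v = ∑ s, G.visitation x G.init s * m x s := by
    rw [policyGradient, mul_inv_cancel_left₀ hp.ne']
  have hmz : ∀ s, |m z s| ≤ e * (1 / (1 - G.discount)) := fun s =>
    abs_weighted_sum_le _ _ _ _ ((sum_abs_deviationWeight z k v s).trans_le (he' s))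
      (by positivity) (G.abs_actionValue_le k z s)
  have h3 := G.abs_sum_visitation_sub_le G.init (Function.update z k q) x E hz' (m z) _
    (by positivity) hmz
  have hmd : ∀ s, |m z s - m x s| ≤ e * (G.discount * (E / (1 - G.discount) ^ 2)) +
      e * E * (1 / (1 - G.discount)) := fun s => by
    have e1 : m z s - m x s =
        ∑ a, deviationWeight z k v s a * (G.actionValue k z s a - G.actionValue k x s a) +
        ∑ a, (deviationWeight z k v s a - deviationWeight x k v s a) * G.actionValue k x s a := by
      simp only [hm]
      rw [← Finset.sum_sub_distrib, ← Finset.sum_add_distrib]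
      exact Finset.sum_congr rfl fun a _ => by ring
    rw [e1]
    refine (abs_add_le _ _).trans (add_le_add ?_ ?_)
    · exact abs_weighted_sum_le _ _ _ _ ((sum_abs_deviationWeight z k v s).trans_le (he' s))
        (mul_nonneg G.discount_nonneg (by positivity)) (G.abs_actionValue_sub_le k z x E hz s)
    · refine abs_weighted_sum_le _ _ _ _ ?_ (by positivity) (G.abs_actionValue_le k x s)
      exact (sum_abs_deviationWeight_sub_le z x k v s).trans
        (mul_le_mul (he' s) (hw s) (Finset.sum_nonneg fun _ _ =>
          Finset.sum_nonneg fun _ _ => abs_nonneg _) he0)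
  have hγ := G.discount_nonneg
  have h4 := G.abs_sum_visitation_le x G.init (fun s => m z s - m x s) _ (by positivity) hmd
  simp only [mul_sub, Finset.sum_sub_distrib] at h4
  have h5 : (1 - G.discount) * (G.value k G.init (Function.update z k q) - G.value k G.init z -
      G.policyGradient k x v) =
      (∑ s, G.visitation (Function.update z k q) G.init s * m z s -
        ∑ s, G.visitation x G.init s * m z s) +
      (∑ s, G.visitation x G.init s * m z s - ∑ s, G.visitation x G.init s * m x s) := by
    rw [mul_sub, h1, h2]
    ring
  have h6 := (congrArg abs h5).trans_le ((abs_add_le _ _).trans (add_le_add h3 h4))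
  rw [abs_mul, abs_of_pos hp] at h6
  -- The three errors add up to (γ + γ + (1 - γ)) e E / (1 - γ)², and 1 + γ is then bounded by 2.
  have h7 : G.discount * E * (e * (1 / (1 - G.discount))) / (1 - G.discount) +
      (e * (G.discount * (E / (1 - G.discount) ^ 2)) + e * E * (1 / (1 - G.discount))) =
      (1 + G.discount) * (e * E) / (1 - G.discount) ^ 2 := by
    field_simp
    ring
  have h8 : (1 + G.discount) * (e * E) / (1 - G.discount) ^ 2 ≤
      2 * (e * E) / (1 - G.discount) ^ 2 := by
    have := G.discount_lt_one
    gcongr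
    linarith
  rw [h7] at h6
  rw [le_div_iff₀ (by positivity)]
  have h9 := h6.trans h8
  rw [le_div_iff₀ (by positivity)] at h9
  linarith [h9]

/-- The potential averaged over the initial distribution. -/
def meanPotential (Φ : S → JointPolicy N S A → ℝ) (π : JointPolicy N S A) : ℝ :=
  ∑ s, (G.init s).toReal * Φ s π

variable {G}

theorem IsPotential.meanPotential_update_sub {Φ : S → JointPolicy N S A → ℝ}
    (hΦ : G.IsPotential Φ) (i : N) (π : JointPolicy N S A) (p : Policy S (A i)) :
    G.meanPotential Φ (Function.update π i p) - G.meanPotential Φ π =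
      G.value i G.init (Function.update π i p) - G.value i G.init π := by
  have h : ∀ s, Φ s (Function.update π i p) - Φ s π =
      G.stateValue i s (Function.update π i p) - G.stateValue i s π := fun s => by
    simpa using hΦ i s π p (π i)
  simp only [meanPotential, value, ← Finset.sum_sub_distrib, ← mul_sub, h]

/-- Pass from `x` to `y` one agent at a time. Each increment of the potential is that agent's own
value increment, and its gradient may be taken at `x` rather than at the current hybrid at a
second-order cost. -/
theorem IsPotential.abs_meanPotential_sub_sub_le {Φ : S → JointPolicy N S A → ℝ}
    (hΦ : G.IsPotential Φ) (x y : JointPolicy N S A) (e : N → ℝ)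
    (he : ∀ j s, ∑ b, |(y j).1 (s, b) - (x j).1 (s, b)| ≤ e j) :
    |G.meanPotential Φ y - G.meanPotential Φ x -
      ∑ k, G.policyGradient k x ((y k).1 - (x k).1)| ≤
        2 * (∑ j, e j) ^ 2 / (1 - G.discount) ^ 3 := by
  have hp := G.one_sub_discount_pos
  obtain ⟨s₀, -⟩ := G.init.support_nonempty
  have he0 : ∀ j, 0 ≤ e j := fun j =>
    (Finset.sum_nonneg fun _ _ => abs_nonneg _).trans (he j s₀)
  set z : Finset N → JointPolicy N S A := fun T j => if j ∈ T then y j else x j with hz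
  have hw : ∀ T s, ∑ j, ∑ b, |(z T j).1 (s, b) - (x j).1 (s, b)| ≤ ∑ j, e j := fun T s => by
    refine Finset.sum_le_sum fun j _ => ?_
    by_cases h : j ∈ T
    · simpa [hz, h] using he j s
    · simpa [hz, h] using he0 j
  have hl : ∀ T s, ∑ a, |profileProb (z T) s a - profileProb x s a| ≤ ∑ j, e j := fun T s =>
    (sum_abs_profileProb_sub_le _ _ s).trans (hw T s)
  have key : ∀ T : Finset N, |G.meanPotential Φ (z T) - G.meanPotential Φ x -
      ∑ k ∈ T, G.policyGradient k x ((y k).1 - (x k).1)| ≤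
        ∑ k ∈ T, 2 * e k * (∑ j, e j) / (1 - G.discount) ^ 3 := by
    intro T
    induction T using Finset.induction_on with
    | empty => simp [hz]
    | insert k T hk ih =>
      have hu : z (insert k T) = Function.update (z T) k (y k) := by
        funext j
        by_cases h : j = k
        · subst h
          simp [hz]
        · simp [hz, h]
      have h1 := G.abs_value_update_sub_policyGradient_le k x (z T) (y k) (by simp [hz, hk])
        (e k) (∑ j, e j) (he k) (hl T) (hw T) (by rw [← hu]; exact hl _)
      rw [← hΦ.meanPotential_update_sub, ← hu] at h1
      rw [Finset.sum_insert hk, Finset.sum_insert hk]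
      refine le_trans (le_of_eq ?_) ((abs_add_le _ _).trans (add_le_add h1 ih))
      congr 1
      ring
  have h := key Finset.univ
  have hy : z Finset.univ = y := by
    funext j
    simp [hz]
  rw [hy] at h
  refine h.trans_eq ?_
  rw [← Finset.sum_div, ← Finset.sum_mul, ← Finset.mul_sum]
  ring

end Game

/-! ### Norms of policies and of greedy perturbations. -/

theorem sum_abs_policy_sub_le_two {B : Type*} [Fintype B] (p q : Policy S B) (s : S) :
    ∑ b, |p.1 (s, b) - q.1 (s, b)| ≤ 2 := by
  have h : ∀ b, |p.1 (s, b) - q.1 (s, b)| ≤ p.1 (s, b) + q.1 (s, b) := fun b => by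
    rw [abs_le]
    constructor <;> linarith [p.2.1 s b, q.2.1 s b]
  refine (Finset.sum_le_sum fun b _ => h b).trans_eq ?_
  rw [Finset.sum_add_distrib, p.2.2 s, q.2.2 s]
  norm_num

theorem sum_abs_le_sqrt_card_mul_norm {B : Type*} [Fintype B] (v : EuclideanSpace ℝ (S × B))
    (s : S) : ∑ b, |v (s, b)| ≤ √(Fintype.card B) * ‖v‖ := by
  classical
  have h1 : (∑ b, |v (s, b)|) ^ 2 ≤ Fintype.card B * ∑ b, |v (s, b)| ^ 2 := by
    simpa using sq_sum_le_card_mul_sum_sq (s := (Finset.univ : Finset B)) (f := fun b => |v (s, b)|)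
  have h2 : ∑ b, |v (s, b)| ^ 2 ≤ ‖v‖ ^ 2 := by
    rw [EuclideanSpace.norm_sq_eq, Fintype.sum_prod_type]
    simp only [Real.norm_eq_abs]
    exact Finset.single_le_sum (f := fun s => ∑ b, |v (s, b)| ^ 2)
      (fun s _ => Finset.sum_nonneg fun b _ => sq_nonneg _) (Finset.mem_univ s)
  refine le_of_sq_le_sq ?_ (by positivity)
  rw [mul_pow, Real.sq_sqrt (by positivity)]
  exact h1.trans (mul_le_mul_of_nonneg_left h2 (by positivity))

theorem norm_policy_sub_sq_le {B : Type*} [Fintype B] (p q : Policy S B) :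
    ‖p.1 - q.1‖ ^ 2 ≤ 4 * Fintype.card S := by
  rw [EuclideanSpace.norm_sq_eq, Fintype.sum_prod_type]
  have h : ∀ s, ∑ b, ‖(p.1 - q.1) (s, b)‖ ^ 2 ≤ 4 := fun s => by
    have h2 := sum_abs_policy_sub_le_two p q s
    have h3 : ∑ b, ‖(p.1 - q.1) (s, b)‖ ^ 2 ≤ (∑ b, |p.1 (s, b) - q.1 (s, b)|) ^ 2 := by
      simp only [Real.norm_eq_abs, PiLp.sub_apply]
      exact Finset.sum_sq_le_sq_sum_of_nonneg fun b _ => abs_nonneg _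
    have h4 : 0 ≤ ∑ b, |p.1 (s, b) - q.1 (s, b)| := Finset.sum_nonneg fun _ _ => abs_nonneg _
    nlinarith
  refine (Finset.sum_le_sum fun s _ => h s).trans_eq ?_
  simp [mul_comm]

theorem greedy_sub_greedy {B : Type*} [Fintype B] [Nonempty B] (α : ℝ)
    (hα : α ∈ Set.Icc (0 : ℝ) 1) (p q : Policy S B) :
    (greedy α hα p).1 - (greedy α hα q).1 = (1 - α) • (p.1 - q.1) := by
  ext z
  simp [greedy]
  ring

theorem norm_greedy_sub_greedy_le {B : Type*} [Fintype B] [Nonempty B] (α : ℝ)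
    (hα : α ∈ Set.Icc (0 : ℝ) 1) (p q : Policy S B) :
    ‖(greedy α hα p).1 - (greedy α hα q).1‖ ≤ ‖p.1 - q.1‖ := by
  rw [greedy_sub_greedy, norm_smul, Real.norm_eq_abs, abs_of_nonneg (by linarith [hα.2])]
  exact mul_le_of_le_one_left (norm_nonneg _) (by linarith [hα.1])

theorem sum_abs_greedy_sub_self_le {B : Type*} [Fintype B] [Nonempty B] (α : ℝ)
    (hα : α ∈ Set.Icc (0 : ℝ) 1) (p : Policy S B) (s : S) :
    ∑ b, |p.1 (s, b) - (greedy α hα p).1 (s, b)| ≤ 2 * α := by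
  have hc : (0 : ℝ) < Fintype.card B := by exact_mod_cast Fintype.card_pos
  have h : ∀ b, |p.1 (s, b) - (greedy α hα p).1 (s, b)| ≤
      α * p.1 (s, b) + α / Fintype.card B := fun b => by
    have h1 := mul_nonneg hα.1 (p.2.1 s b)
    have h2 := div_nonneg hα.1 hc.le
    simp only [greedy]
    rw [abs_le]
    constructor <;> linarith
  refine (Finset.sum_le_sum fun b _ => h b).trans_eq ?_
  rw [Finset.sum_add_distrib, ← Finset.mul_sum, p.2.2 s]
  simp
  field_simp
  ring

/-! ### Gradient domination and the Nash gap. -/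

namespace Game

variable {G : Game N S A}

theorem visitation_le_one (π : JointPolicy N S A) (ν : PMF S) (s : S) :
    G.visitation π ν s ≤ 1 := by
  rw [← G.sum_visitation π ν]
  exact Finset.single_le_sum (fun s _ => G.visitation_nonneg π ν s) (Finset.mem_univ s)

theorem visitation_le_mismatch_mul {I : Set (PMF S)}
    (hD : ∀ ν ∈ I, ∀ (π : JointPolicy N S A) (s : S), G.init s = 0 → G.visitation π ν s = 0)
    {ν : PMF S} (hν : ν ∈ I) (π : JointPolicy N S A) (s : S) :
    G.visitation π ν s ≤ G.mismatch I * (G.init s).toReal := by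
  by_cases h0 : G.init s = 0
  · simp [hD ν hν π s h0, h0]
  have hpos : 0 < (G.init s).toReal := ENNReal.toReal_pos h0 (G.init.apply_ne_top s)
  rw [← div_le_iff₀ hpos]
  have hb : BddAbove (Set.range fun z : I × JointPolicy N S A × S =>
      G.visitation z.2.1 z.1.1 z.2.2 / (G.init z.2.2).toReal) := by
    -- Boundedness is what gives the real supremum its meaning. States of zero initial mass
    -- contribute 0, since division by zero is 0.
    refine ⟨∑ s, 1 / (G.init s).toReal, ?_⟩
    rintro _ ⟨z, rfl⟩
    refine le_trans ?_ (Finset.single_le_sum (f := fun s => 1 / (G.init s).toReal)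
      (fun s _ => by positivity) (Finset.mem_univ z.2.2))
    exact div_le_div_of_nonneg_right (visitation_le_one _ _ _) ENNReal.toReal_nonneg
  exact le_ciSup hb (⟨ν, hν⟩, π, s)

/-- Summing the pointwise domination over the states compares two probability vectors, of total mass
1 each. -/
theorem one_le_mismatch [∀ i, Nonempty (A i)] {I : Set (PMF S)} (hI : I.Nonempty)
    (hD : ∀ ν ∈ I, ∀ (π : JointPolicy N S A) (s : S), G.init s = 0 → G.visitation π ν s = 0) :
    1 ≤ G.mismatch I := by
  obtain ⟨ν, hν⟩ := hI
  let π : JointPolicy N S A := fun i => ⟨_, (policySet_nonempty S (A i)).some_mem⟩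
  have h := Finset.sum_le_sum fun s (_ : s ∈ Finset.univ) => visitation_le_mismatch_mul hD hν π s
  rwa [sum_visitation, ← Finset.mul_sum, sum_toReal_pmf, mul_one] at h

/-- Gradient domination. The visitation of the deviating policy is at most D times the initial law,
which is at most (1 - γ)⁻¹ times the visitation of the current policy. Both comparisons apply to
nonnegative quantities only, hence the passage to positive parts of the advantage. -/
theorem value_update_greedy_sub_le [∀ i, Nonempty (A i)] {I : Set (PMF S)}
    (hI : I.Nonempty)
    (hD : ∀ ν ∈ I, ∀ (π : JointPolicy N S A) (s : S), G.init s = 0 → G.visitation π ν s = 0)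
    (α : ℝ) (hα : α ∈ Set.Icc (0 : ℝ) 1) (x : JointPolicy N S A) (i : N) (B : ℝ)
    (hB : ∀ y : Policy S (A i), G.policyGradient i (fun j => greedy α hα (x j))
      ((greedy α hα y).1 - (greedy α hα (x i)).1) ≤ B) (q : Policy S (A i)) (ν : PMF S)
    (hν : ν ∈ I) :
    G.value i ν (Function.update (fun j => greedy α hα (x j)) i (greedy α hα q)) -
      G.value i ν (fun j => greedy α hα (x j)) ≤ G.mismatch I / (1 - G.discount) * B := by
  classical
  have hp := G.one_sub_discount_pos
  set π : JointPolicy N S A := fun j => greedy α hα (x j) with hπ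
  set adv : S → ℝ := fun s => ∑ a, deviationWeight π i
    ((greedy α hα q).1 - (greedy α hα (x i)).1) s a * G.actionValue i π s a with hadv
  -- Deviating only at the states with nonnegative advantage makes the positive part of the
  -- advantage the actual advantage of a policy, to which `hB` applies.
  let y : Policy S (A i) :=
    ⟨WithLp.toLp 2 fun z => if 0 ≤ adv z.1 then q.1 z else (x i).1 z, fun s b => by
      dsimp only
      split_ifs
      · exact q.2.1 s b
      · exact (x i).2.1 s b, fun s => by
      dsimp only
      split_ifs
      · exact q.2.2 s
      · exact (x i).2.2 s⟩
  have hy : ∀ s, ∑ a, deviationWeight π i ((greedy α hα y).1 - (greedy α hα (x i)).1) s a *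
      G.actionValue i π s a = max (adv s) 0 := by
    intro s
    by_cases h : 0 ≤ adv s
    · rw [max_eq_left h]
      simp only [hadv]
      refine Finset.sum_congr rfl fun a _ => ?_
      congr 1
      simp only [deviationWeight, greedy, PiLp.sub_apply, y, h, if_true]
    · rw [max_eq_right (not_le.1 h).le]
      refine Finset.sum_eq_zero fun a _ => ?_
      simp only [deviationWeight, greedy, PiLp.sub_apply, y, h, if_false, sub_self, zero_mul]
  have h1 := G.value_update_sub i i ν π (greedy α hα q)
  have h2 : ∑ s, G.visitation (Function.update π i (greedy α hα q)) ν s * adv s ≤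
      ∑ s, G.mismatch I * ((G.init s).toReal * max (adv s) 0) := by
    refine Finset.sum_le_sum fun s _ => ?_
    rw [← mul_assoc]
    exact (mul_le_mul_of_nonneg_left (le_max_left _ _) (G.visitation_nonneg _ _ _)).trans
      (mul_le_mul_of_nonneg_right (visitation_le_mismatch_mul hD hν _ s) (le_max_right _ _))
  have h3 : ∑ s, (1 - G.discount) * ((G.init s).toReal * max (adv s) 0) ≤
      ∑ s, G.visitation π G.init s * max (adv s) 0 := by
    refine Finset.sum_le_sum fun s _ => ?_
    rw [← mul_assoc]
    exact mul_le_mul_of_nonneg_right (G.le_visitation π G.init s) (le_max_right _ _)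
  have h4 := hB y
  simp only [policyGradient, hy] at h4
  rw [inv_mul_le_iff₀ hp] at h4
  rw [← Finset.mul_sum] at h2 h3
  have h5 := le_of_mul_le_mul_left (h3.trans h4) hp
  have h6 := mul_le_mul_of_nonneg_left h5 (zero_le_one.trans (one_le_mismatch hI hD))
  rw [div_mul_eq_mul_div, le_div_iff₀ hp, mul_comm, h1]
  exact h2.trans h6

/-- Three costs: making the deviation greedy moves it by at most 2α in L¹, the greedy deviation from
`x'` is controlled by gradient domination, and passing between `x` and `x'` is paid twice, with and
without the deviation. -/
theorem nashGap_greedy_le [∀ i, Nonempty (A i)] {I : Set (PMF S)}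
    (hI : I.Nonempty)
    (hD : ∀ ν ∈ I, ∀ (π : JointPolicy N S A) (s : S), G.init s = 0 → G.visitation π ν s = 0)
    (α : ℝ) (hα : α ∈ Set.Icc (0 : ℝ) 1) (x x' : JointPolicy N S A) (B E : ℝ) (hB0 : 0 ≤ B)
    (hB : ∀ i, ∀ y : Policy S (A i), G.policyGradient i (fun j => greedy α hα (x' j))
      ((greedy α hα y).1 - (greedy α hα (x' i)).1) ≤ B)
    (hE : ∀ s, ∑ j, ∑ b, |(greedy α hα (x j)).1 (s, b) - (greedy α hα (x' j)).1 (s, b)| ≤ E) :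
    G.nashGap I (fun j => greedy α hα (x j)) ≤
      2 * α / (1 - G.discount) ^ 2 + G.mismatch I / (1 - G.discount) * B +
        2 * E / (1 - G.discount) ^ 2 := by
  have hp := G.one_sub_discount_pos
  obtain ⟨s₀, -⟩ := G.init.support_nonempty
  have hE0 : 0 ≤ E := (Finset.sum_nonneg fun _ _ => Finset.sum_nonneg fun _ _ =>
    abs_nonneg _).trans (hE s₀)
  have hm := zero_le_one.trans (one_le_mismatch hI hD)
  have hα0 := hα.1
  refine csInf_le ⟨0, fun _ h => h.1⟩ ⟨by positivity, fun i p ν hν => ?_⟩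
  set π : JointPolicy N S A := fun j => greedy α hα (x j) with hπ
  set π' : JointPolicy N S A := fun j => greedy α hα (x' j) with hπ'
  have h1 := G.abs_value_sub_le i ν (Function.update π i p) (Function.update π' i p) E fun s =>
    (sum_abs_profileProb_sub_le _ _ s).trans ((sum_abs_sub_update_le π' π i p s).trans (hE s))
  have h2 := G.abs_value_sub_le i ν (Function.update π' i p)
    (Function.update π' i (greedy α hα p)) (2 * α) fun s => by
      refine (sum_abs_profileProb_sub_le _ _ s).trans ?_
      rw [Finset.sum_eq_single i]
      · simpa using sum_abs_greedy_sub_self_le α hα p s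
      · intro j _ hj
        simp [Function.update_of_ne hj]
      · simp
  have h3 := value_update_greedy_sub_le hI hD α hα x' i B (hB i) p ν hν
  have h4 := G.abs_value_sub_le i ν π π' E fun s =>
    (sum_abs_profileProb_sub_le _ _ s).trans (hE s)
  rw [abs_le] at h1 h2 h4
  have h5 : 2 * E / (1 - G.discount) ^ 2 = E / (1 - G.discount) ^ 2 + E / (1 - G.discount) ^ 2 := by
    ring
  linarith [h1.2, h2.2, h4.1]

theorem abs_policyGradient_le (k : N) (π : JointPolicy N S A) (v : EuclideanSpace ℝ (S × A k))
    (e : ℝ) (he : ∀ s, ∑ b, |v (s, b)| ≤ e) :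
    |G.policyGradient k π v| ≤ e / (1 - G.discount) ^ 2 := by
  have hp := G.one_sub_discount_pos
  obtain ⟨s₀, -⟩ := G.init.support_nonempty
  have he0 : 0 ≤ e := (Finset.sum_nonneg fun _ _ => abs_nonneg _).trans (he s₀)
  have h := G.abs_sum_visitation_le π G.init
    (fun s => ∑ a, deviationWeight π k v s a * G.actionValue k π s a)
    (e * (1 / (1 - G.discount))) (by positivity) fun s => abs_weighted_sum_le _ _ _ _
      ((sum_abs_deviationWeight π k v s).trans_le (he s)) (by positivity)
      (G.abs_actionValue_le k π s)
  rw [policyGradient, abs_mul, abs_of_pos (inv_pos.2 hp), inv_mul_le_iff₀ hp]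
  refine h.trans_eq ?_
  field_simp

theorem IsPotential.abs_meanPotential_sub_le {Φ : S → JointPolicy N S A → ℝ}
    (hΦ : G.IsPotential Φ) (x y : JointPolicy N S A) (e : N → ℝ)
    (he : ∀ j s, ∑ b, |(y j).1 (s, b) - (x j).1 (s, b)| ≤ e j) :
    |G.meanPotential Φ y - G.meanPotential Φ x| ≤
      (∑ j, e j) / (1 - G.discount) ^ 2 + 2 * (∑ j, e j) ^ 2 / (1 - G.discount) ^ 3 := by
  have h1 := hΦ.abs_meanPotential_sub_sub_le x y e he
  have h2 : |∑ k, G.policyGradient k x ((y k).1 - (x k).1)| ≤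
      (∑ j, e j) / (1 - G.discount) ^ 2 := by
    rw [Finset.sum_div]
    exact (Finset.abs_sum_le_sum_abs _ _).trans
      (Finset.sum_le_sum fun k _ => abs_policyGradient_le k x _ _ (he k))
  rw [abs_le] at *
  constructor <;> linarith [h1.1, h1.2, h2.1, h2.2]

/-- The content is that the supremum is over a bounded set: any two policies are within 2 per agent
and state, and the expansion bounds the change of the potential. -/
theorem IsPotential.meanPotential_sub_le_potentialRange {Φ : S → JointPolicy N S A → ℝ}
    (hΦ : G.IsPotential Φ) (x y : JointPolicy N S A) :
    G.meanPotential Φ x - G.meanPotential Φ y ≤ G.potentialRange Φ := by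
  refine le_ciSup (f := fun z : JointPolicy N S A × JointPolicy N S A =>
    G.meanPotential Φ z.1 - G.meanPotential Φ z.2) ?_ (x, y)
  refine ⟨(∑ _j : N, 2) / (1 - G.discount) ^ 2 +
    2 * (∑ _j : N, 2) ^ 2 / (1 - G.discount) ^ 3, ?_⟩
  rintro _ ⟨z, rfl⟩
  exact (le_abs_self _).trans (hΦ.abs_meanPotential_sub_le z.2 z.1 (fun _ => 2)
    fun j s => sum_abs_policy_sub_le_two _ _ s)

end Game

/-! ### Compactness and proximal points. -/

theorem card_le_maxActions (i : N) : Fintype.card (A i) ≤ maxActions N A :=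
  Finset.le_sup (f := fun i => Fintype.card (A i)) (Finset.mem_univ i)

instance compactSpace_policy (B : Type*) [Fintype B] : CompactSpace (Policy S B) := by
  rw [← isCompact_iff_compactSpace]
  refine Metric.isCompact_of_isClosed_isBounded (isClosed_policySet S B)
    (Metric.isBounded_iff.2 ⟨√(4 * Fintype.card S), fun x hx y hy => ?_⟩)
  rw [dist_eq_norm]
  exact Real.le_sqrt_of_sq_le (norm_policy_sub_sq_le (⟨x, hx⟩ : Policy S B) ⟨y, hy⟩)

/-- The proximal point of a smooth function on a compact convex set, presented as the image of
`ι`: `L x` is the derivative at `x`. -/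
theorem exists_proximal_point {P E : Type*} [TopologicalSpace P] [CompactSpace P]
    [NormedAddCommGroup E] [InnerProductSpace ℝ E] (ι : P → E) (hι : Continuous ι)
    (hseg : ∀ x y : P, ∀ t ∈ Set.Icc (0 : ℝ) 1, ∃ z, ι z = ι x + t • (ι y - ι x))
    (F : P → ℝ) (hF : Continuous F) (L : P → E → ℝ) (hL : ∀ x v (t : ℝ), L x (t • v) = t * L x v)
    (β : ℝ)
    (hβ : ∀ x y, |F y - F x - L x (ι y - ι x)| ≤ β / 2 * ‖ι y - ι x‖ ^ 2) (x : P) :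
    ∃ z, (∀ y, F y - β * ‖ι y - ι x‖ ^ 2 ≤ F z - β * ‖ι z - ι x‖ ^ 2) ∧
      (∀ y, L z (ι y - ι z) ≤ 2 * β * inner ℝ (ι z - ι x) (ι y - ι z)) ∧
      β * ‖ι z - ι x‖ ^ 2 ≤ L x (ι z - ι x) := by
  obtain ⟨z, -, hz⟩ := isCompact_univ.exists_isMaxOn (f := fun y => F y - β * ‖ι y - ι x‖ ^ 2)
    ⟨x, Set.mem_univ x⟩ (by fun_prop)
  have hmax : ∀ y, F y - β * ‖ι y - ι x‖ ^ 2 ≤ F z - β * ‖ι z - ι x‖ ^ 2 := fun y =>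
    hz (Set.mem_univ y)
  have hopt : ∀ y, L z (ι y - ι z) ≤ 2 * β * inner ℝ (ι z - ι x) (ι y - ι z) := by
    intro y
    -- Along the segment the penalty contributes β to the t² term and the smoothness remainder β /
    -- 2. Dividing by t and letting t tend to 0 gives the first-order condition.
    set c := 3 / 2 * β * ‖ι y - ι z‖ ^ 2 with hc
    set d := L z (ι y - ι z) - 2 * β * inner ℝ (ι z - ι x) (ι y - ι z) with hd
    have hle : ∀ t : ℝ, 0 < t → t ≤ 1 → d ≤ t * c := by
      intro t ht ht1
      obtain ⟨w, hw⟩ := hseg z y t ⟨ht.le, ht1⟩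
      have h1 := hmax w
      have h2 := (abs_le.1 (hβ z w)).1
      have e1 : ι w - ι z = t • (ι y - ι z) := by rw [hw]; abel
      have e2 : ‖ι w - ι x‖ ^ 2 = ‖ι z - ι x‖ ^ 2 + 2 * (t * inner ℝ (ι z - ι x) (ι y - ι z)) +
          t ^ 2 * ‖ι y - ι z‖ ^ 2 := by
        have : ι w - ι x = (ι z - ι x) + t • (ι y - ι z) := by rw [hw]; abel
        rw [this, norm_add_sq_real, inner_smul_right, norm_smul, mul_pow, Real.norm_eq_abs, sq_abs]
      rw [e1, hL, norm_smul, mul_pow, Real.norm_eq_abs, sq_abs] at h2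
      rw [e2] at h1
      refine le_of_mul_le_mul_left ?_ ht
      rw [hd, hc]
      nlinarith
    have h0 : d ≤ 0 := by
      refine le_of_forall_pos_lt_add fun δ hδ => ?_
      have hc1 : 0 < |c| + 1 := by positivity
      set t := min 1 (δ / (2 * (|c| + 1))) with ht
      have ht0 : 0 < t := lt_min one_pos (by positivity)
      have h1 := hle t ht0 (min_le_left _ _)
      have h2 : t * c ≤ t * (|c| + 1) :=
        mul_le_mul_of_nonneg_left (by linarith [le_abs_self c]) ht0.le
      have h3 : t * (|c| + 1) ≤ δ / (2 * (|c| + 1)) * (|c| + 1) :=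
        mul_le_mul_of_nonneg_right (min_le_right _ _) hc1.le
      have h4 : δ / (2 * (|c| + 1)) * (|c| + 1) = δ / 2 := by
        field_simp
      linarith
    linarith
  refine ⟨z, hmax, hopt, ?_⟩
  -- Testing optimality against `x` gives slope at least 2β‖z - x‖² at `z`. The two expansions
  -- between `x` and `z` change the slope by at most β‖z - x‖², which leaves β‖z - x‖² at `x`.
  have h1 := hopt x
  have h2 := (abs_le.1 (hβ z x)).2
  have h3 := (abs_le.1 (hβ x z)).2
  have e1 : inner ℝ (ι z - ι x) (ι x - ι z) = - ‖ι z - ι x‖ ^ 2 := by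
    rw [← neg_sub (ι z) (ι x), inner_neg_right, real_inner_self_eq_norm_sq]
  rw [e1] at h1
  rw [norm_sub_rev] at h2
  linarith

/-! ### Expectations under discrete laws as sums in `ENNReal`. -/

theorem tsum_pure_mul {B : Type*} (b : B) (f : B → ENNReal) :
    ∑' y, PMF.pure b y * f y = f b := by
  classical
  rw [tsum_eq_single b]
  · simp
  · intro y hy
    simp [PMF.pure_apply, hy]

theorem tsum_bind_mul {B C : Type*} (p : PMF B) (q : B → PMF C) (f : C → ENNReal) :
    ∑' c, p.bind q c * f c = ∑' b, p b * ∑' c, q b c * f c := by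
  simp_rw [PMF.bind_apply, ← ENNReal.tsum_mul_right, ← ENNReal.tsum_mul_left, mul_assoc]
  exact ENNReal.tsum_comm

theorem tsum_map_mul {B C : Type*} (p : PMF B) (g : B → C) (f : C → ENNReal) :
    ∑' c, p.map g c * f c = ∑' b, p b * f (g b) := by
  rw [← PMF.bind_pure_comp, tsum_bind_mul]
  simp only [Function.comp_apply, tsum_pure_mul]

theorem tsum_mul_ofReal {B : Type*} [Fintype B] (p : PMF B) (f : B → ℝ) (hf : ∀ b, 0 ≤ f b) :
    ∑' b, p b * ENNReal.ofReal (f b) = ENNReal.ofReal (∑ b, (p b).toReal * f b) := by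
  rw [tsum_fintype, ENNReal.ofReal_sum_of_nonneg fun b _ =>
    mul_nonneg ENNReal.toReal_nonneg (hf b)]
  refine Finset.sum_congr rfl fun b _ => ?_
  rw [ENNReal.ofReal_mul ENNReal.toReal_nonneg, ENNReal.ofReal_toReal (p.apply_ne_top b)]

/-! ### Trajectories with geometric horizon and the gradient estimator's mean. -/

namespace Game

variable (G : Game N S A)

/-- The expectation of `f` over trajectories of `π` of horizon `k` from `s`. -/
def pathExp (π : JointPolicy N S A) : ℕ → S → (List (S × ∀ i, A i) → ℝ) → ℝ
  | 0, s, f => ∑ a, profileProb π s a * f [(s, a)]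
  | k + 1, s, f => ∑ a, profileProb π s a *
      G.nextExp (fun s' => pathExp π k s' fun l => f ((s, a) :: l)) s a

theorem pathExp_mono (π : JointPolicy N S A) (k : ℕ) (s : S) (f g : List (S × ∀ i, A i) → ℝ)
    (h : ∀ l, l.length = k + 1 → f l ≤ g l) : G.pathExp π k s f ≤ G.pathExp π k s g := by
  induction k generalizing s f g with
  | zero =>
    exact Finset.sum_le_sum fun a _ =>
      mul_le_mul_of_nonneg_left (h _ rfl) (profileProb_nonneg π s a)
  | succ k ih =>
    refine Finset.sum_le_sum fun a _ => mul_le_mul_of_nonneg_left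
      (Finset.sum_le_sum fun s' _ => mul_le_mul_of_nonneg_left (ih s' _ _ fun l hl => ?_)
        ENNReal.toReal_nonneg) (profileProb_nonneg π s a)
    exact h _ (by simp [hl])

theorem pathExp_add (π : JointPolicy N S A) (k : ℕ) (s : S) (f g : List (S × ∀ i, A i) → ℝ) :
    G.pathExp π k s (fun l => f l + g l) = G.pathExp π k s f + G.pathExp π k s g := by
  induction k generalizing s f g with
  | zero => simp only [pathExp, mul_add, Finset.sum_add_distrib]
  | succ k ih => simp only [pathExp, nextExp, ih, mul_add, Finset.sum_add_distrib]

theorem pathExp_const_mul (π : JointPolicy N S A) (k : ℕ) (s : S) (c : ℝ)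
    (f : List (S × ∀ i, A i) → ℝ) :
    G.pathExp π k s (fun l => c * f l) = c * G.pathExp π k s f := by
  induction k generalizing s f with
  | zero => simp only [pathExp, mul_left_comm _ c, Finset.mul_sum]
  | succ k ih => simp only [pathExp, nextExp, ih, mul_left_comm _ c, Finset.mul_sum]

theorem pathExp_const (π : JointPolicy N S A) (k : ℕ) (s : S) (c : ℝ) :
    G.pathExp π k s (fun _ => c) = c := by
  induction k generalizing s with
  | zero => simp only [pathExp, ← Finset.sum_mul, sum_profileProb, one_mul]
  | succ k ih => simp only [pathExp, ih, nextExp_const, ← Finset.sum_mul, sum_profileProb, one_mul]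

theorem pathExp_sum {B : Type*} (T : Finset B) (π : JointPolicy N S A) (k : ℕ) (s : S)
    (f : B → List (S × ∀ i, A i) → ℝ) :
    G.pathExp π k s (fun l => ∑ b ∈ T, f b l) = ∑ b ∈ T, G.pathExp π k s (f b) := by
  classical
  induction T using Finset.induction_on with
  | empty => simpa using G.pathExp_const π k s 0
  | insert b T hb ih => simp only [Finset.sum_insert hb, pathExp_add, ih]

theorem abs_pathExp_le (π : JointPolicy N S A) (k : ℕ) (s : S) (f : List (S × ∀ i, A i) → ℝ)
    (M : ℝ) (h : ∀ l, l.length = k + 1 → |f l| ≤ M) : |G.pathExp π k s f| ≤ M := by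
  rw [abs_le]
  constructor
  · rw [← G.pathExp_const π k s (-M)]
    exact G.pathExp_mono π k s _ _ fun l hl => (abs_le.1 (h l hl)).1
  · rw [← G.pathExp_const π k s M]
    exact G.pathExp_mono π k s _ _ fun l hl => (abs_le.1 (h l hl)).2

/-- Bridge between the two forms of expectation: the real-valued recursion `pathExp` is linear and
allows signed integrands, while the `ENNReal` sum is the one in the statement about iterates. -/
theorem tsum_pathLaw (π : JointPolicy N S A) (k : ℕ) (s : S) (f : List (S × ∀ i, A i) → ℝ)
    (hf : ∀ l, 0 ≤ f l) :
    ∑' l, G.pathLaw π k s l * ENNReal.ofReal (f l) = ENNReal.ofReal (G.pathExp π k s f) := by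
  induction k generalizing s f with
  | zero =>
    simp only [pathLaw, tsum_map_mul]
    rw [tsum_mul_ofReal _ _ fun a => hf _]
    simp only [toReal_actionLaw, pathExp]
  | succ k ih =>
    have h0 : ∀ s' a, 0 ≤ G.pathExp π k s' fun l => f ((s, a) :: l) := fun s' a => by
      rw [← G.pathExp_const π k s' 0]
      exact G.pathExp_mono π k s' _ _ fun l _ => hf _
    simp only [pathLaw, tsum_bind_mul, tsum_map_mul]
    simp_rw [ih _ _ fun l => hf _]
    simp_rw [tsum_mul_ofReal (G.trans s _) (fun s' => G.pathExp π k s' fun l => f ((s, _) :: l))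
      fun s' => h0 s' _]
    rw [tsum_mul_ofReal _ _ fun a =>
      Finset.sum_nonneg fun s' _ => mul_nonneg ENNReal.toReal_nonneg (h0 s' a)]
    simp only [toReal_actionLaw, pathExp, nextExp]

/-- The expectation of `f` over trajectories of `π` of horizon `k` from the initial law. -/
def startExp (π : JointPolicy N S A) (k : ℕ) (f : List (S × ∀ i, A i) → ℝ) : ℝ :=
  ∑ s, (G.init s).toReal * G.pathExp π k s f

theorem tsum_trajectoryLaw (π : JointPolicy N S A) (f : List (S × ∀ i, A i) → ℝ)
    (hf : ∀ l, 0 ≤ f l) (M : ℝ)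
    (hM : HasSum (fun k : ℕ => (1 - G.discount) * G.discount ^ k * G.startExp π k f) M) :
    ∑' l, G.trajectoryLaw π l * ENNReal.ofReal (f l) = ENNReal.ofReal M := by
  have h0 : ∀ k s, 0 ≤ G.pathExp π k s f := fun k s => by
    rw [← G.pathExp_const π k s 0]
    exact G.pathExp_mono π k s _ _ fun l _ => hf _
  have hw : ∀ k : ℕ, 0 ≤ (1 - G.discount) * G.discount ^ k := fun k =>
    mul_nonneg G.one_sub_discount_pos.le (pow_nonneg G.discount_nonneg k)
  have h1 : ∀ k, 0 ≤ G.startExp π k f := fun k =>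
    Finset.sum_nonneg fun s _ => mul_nonneg ENNReal.toReal_nonneg (h0 k s)
  simp only [trajectoryLaw, tsum_bind_mul, G.tsum_pathLaw π _ _ f hf]
  simp_rw [tsum_mul_ofReal G.init (fun s => G.pathExp π _ s f) fun s => h0 _ s]
  rw [← hM.tsum_eq, ENNReal.ofReal_tsum_of_nonneg (fun k => mul_nonneg (hw k) (h1 k)) hM.summable]
  refine tsum_congr fun k => ?_
  rw [ENNReal.ofReal_mul (hw k)]
  rfl

theorem hasSum_horizon_choose :
    HasSum (fun k : ℕ => (1 - G.discount) * G.discount ^ k * (24 * ((k + 4).choose 4 : ℝ)))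
      (24 / (1 - G.discount) ^ 4) := by
  have hp := G.one_sub_discount_pos
  have h := (hasSum_choose_mul_geometric_of_norm_lt_one (𝕜 := ℝ) 4 (r := G.discount)
    (by rw [Real.norm_eq_abs, abs_of_nonneg G.discount_nonneg]; exact G.discount_lt_one)).mul_left
      (24 * (1 - G.discount))
  have e1 : (fun k : ℕ => (1 - G.discount) * G.discount ^ k * (24 * ((k + 4).choose 4 : ℝ))) =
      fun k : ℕ => 24 * (1 - G.discount) * (((k + 4).choose 4 : ℝ) * G.discount ^ k) := by
    funext k
    ring
  have e2 : 24 / (1 - G.discount) ^ 4 =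
      24 * (1 - G.discount) * (1 / (1 - G.discount) ^ (4 + 1)) := by
    field_simp
  rw [e1, e2]
  exact h

/-- Exchanges the fourth power of the trajectory length for a binomial coefficient, whose geometric
average is explicit. -/
theorem succ_pow_four_le (k : ℕ) : ((k : ℝ) + 1) ^ 4 ≤ 24 * ((k + 4).choose 4 : ℝ) := by
  have h := Nat.pow_sub_le_descFactorial (k + 4) 4
  rw [Nat.descFactorial_eq_factorial_mul_choose] at h
  have h2 : (k + 4 + 1 - 4) = k + 1 := by omega
  rw [h2] at h
  exact_mod_cast h

theorem summable_horizon_mul (a : ℕ → ℝ) (C : ℝ) (ha : ∀ k, |a k| ≤ C * ((k : ℝ) + 1) ^ 4) :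
    Summable fun k : ℕ => (1 - G.discount) * G.discount ^ k * a k := by
  have hw : ∀ k : ℕ, 0 ≤ (1 - G.discount) * G.discount ^ k := fun k =>
    mul_nonneg G.one_sub_discount_pos.le (pow_nonneg G.discount_nonneg k)
  have hC : 0 ≤ C := by simpa using (abs_nonneg _).trans (ha 0)
  refine Summable.of_norm_bounded (G.hasSum_horizon_choose.summable.mul_left C) fun k => ?_
  rw [Real.norm_eq_abs, abs_mul, abs_of_nonneg (hw k), mul_left_comm]
  exact mul_le_mul_of_nonneg_left ((ha k).trans
    (mul_le_mul_of_nonneg_left (succ_pow_four_le k) hC)) (hw k)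

theorem hasSum_horizon :
    HasSum (fun k : ℕ => (1 - G.discount) * G.discount ^ k) 1 := by
  have h := (hasSum_geometric_of_lt_one G.discount_nonneg G.discount_lt_one).mul_left
    (1 - G.discount)
  rwa [mul_inv_cancel₀ G.one_sub_discount_pos.ne'] at h

/-- The sum of `h` along a trajectory. -/
def pathSum (h : S → (∀ i, A i) → ℝ) (l : List (S × ∀ i, A i)) : ℝ :=
  (l.map fun z => h z.1 z.2).sum

theorem pathSum_cons (h : S → (∀ i, A i) → ℝ) (s : S) (a : ∀ i, A i)
    (l : List (S × ∀ i, A i)) : pathSum h ((s, a) :: l) = h s a + pathSum h l := by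
  simp [pathSum]

theorem pathSum_singleton (h : S → (∀ i, A i) → ℝ) (s : S) (a : ∀ i, A i) :
    pathSum h [(s, a)] = h s a := by
  simp [pathSum]

theorem abs_pathSum_le (h : S → (∀ i, A i) → ℝ) (C : ℝ) (hC : ∀ s a, |h s a| ≤ C)
    (l : List (S × ∀ i, A i)) : |pathSum h l| ≤ l.length * C := by
  induction l with
  | nil => simp [pathSum]
  | cons z l ih =>
    rw [pathSum_cons]
    refine (abs_add_le _ _).trans ((add_le_add (hC _ _) ih).trans_eq ?_)
    push_cast [List.length_cons]
    ring

theorem pathExp_pathSum_succ (π : JointPolicy N S A) (h : S → (∀ i, A i) → ℝ) (k : ℕ) (s : S) :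
    G.pathExp π (k + 1) s (pathSum h) = ∑ a, profileProb π s a * h s a +
      G.policyNext π (fun s' => G.pathExp π k s' (pathSum h)) s := by
  simp only [pathExp, pathSum_cons, pathExp_add, pathExp_const, policyNext, nextExp, mul_add,
    Finset.sum_add_distrib]
  congr 1
  simp only [← Finset.sum_mul, sum_toReal_pmf, one_mul]

theorem pathExp_pathSum_le (π : JointPolicy N S A) (h : S → (∀ i, A i) → ℝ) (M : ℝ)
    (hM : ∀ s, ∑ a, profileProb π s a * h s a ≤ M) (k : ℕ) (s : S) :
    G.pathExp π k s (pathSum h) ≤ (k + 1) * M := by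
  induction k generalizing s with
  | zero => simpa [pathExp, pathSum_singleton] using hM s
  | succ k ih =>
    rw [pathExp_pathSum_succ]
    have h1 : G.policyNext π (fun s' => G.pathExp π k s' (pathSum h)) s ≤ (k + 1) * M := by
      rw [← G.policyNext_const π ((k + 1) * M) s]
      exact Finset.sum_le_sum fun a _ => mul_le_mul_of_nonneg_left
        (Finset.sum_le_sum fun s' _ => mul_le_mul_of_nonneg_left (ih s') ENNReal.toReal_nonneg)
        (profileProb_nonneg π s a)
    push_cast
    linarith [hM s]

theorem pathExp_pathSum_eq_zero (π : JointPolicy N S A) (h : S → (∀ i, A i) → ℝ)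
    (h0 : ∀ s, ∑ a, profileProb π s a * h s a = 0) (k : ℕ) (s : S) :
    G.pathExp π k s (pathSum h) = 0 := by
  induction k generalizing s with
  | zero => simpa [pathExp, pathSum_singleton] using h0 s
  | succ k ih =>
    rw [pathExp_pathSum_succ, h0]
    simp only [ih, policyNext_const, add_zero]

/-- Expand both sums at the first step. The first reward times the later scores averages to zero
because `h` is centred at each state; what remains is the first score times the total reward, plus
the same quantity for the tail. -/
theorem pathExp_mul_pathSum_succ (π : JointPolicy N S A) (r h : S → (∀ i, A i) → ℝ)
    (h0 : ∀ s, ∑ a, profileProb π s a * h s a = 0) (k : ℕ) (s : S) :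
    G.pathExp π (k + 1) s (fun l => pathSum r l * pathSum h l) =
      ∑ a, profileProb π s a * (h s a *
        (r s a + G.nextExp (fun s' => G.pathExp π k s' (pathSum r)) s a)) +
      G.policyNext π (fun s' => G.pathExp π k s' fun l => pathSum r l * pathSum h l) s := by
  rw [policyNext, ← Finset.sum_add_distrib, pathExp]
  refine Finset.sum_congr rfl fun a _ => ?_
  rw [← mul_add]
  congr 1
  have e : ∀ s', (G.pathExp π k s' fun l => pathSum r ((s, a) :: l) * pathSum h ((s, a) :: l)) =
      h s a * r s a + h s a * G.pathExp π k s' (pathSum r) +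
        G.pathExp π k s' fun l => pathSum r l * pathSum h l := by
    intro s'
    have e1 : (fun l => pathSum r ((s, a) :: l) * pathSum h ((s, a) :: l)) =
        fun l => ((h s a * r s a + h s a * pathSum r l) + r s a * pathSum h l) +
          pathSum r l * pathSum h l := by
      funext l
      rw [pathSum_cons, pathSum_cons]
      ring
    rw [e1, pathExp_add, pathExp_add, pathExp_add, pathExp_const, pathExp_const_mul,
      pathExp_const_mul, G.pathExp_pathSum_eq_zero π h h0]
    ring
  simp only [e, nextExp, mul_add, Finset.sum_add_distrib, ← Finset.sum_mul, sum_toReal_pmf,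
    one_mul, Finset.mul_sum]
  congr 2
  exact Finset.sum_congr rfl fun _ _ => by ring

theorem hasSum_policyNext (π : JointPolicy N S A) (u : ℕ → S → ℝ) (v : S → ℝ)
    (h : ∀ s, HasSum (fun k => u k s) (v s)) (s : S) :
    HasSum (fun k => G.policyNext π (u k) s) (G.policyNext π v s) :=
  hasSum_sum fun _ _ => (hasSum_sum fun s' _ => (h s').mul_left _).mul_left _

theorem hasSum_nextExp (u : ℕ → S → ℝ) (v : S → ℝ)
    (h : ∀ s, HasSum (fun k => u k s) (v s)) (s : S) (a : ∀ i, A i) :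
    HasSum (fun k => G.nextExp (u k) s a) (G.nextExp v s a) :=
  hasSum_sum fun s' _ => (h s').mul_left _

theorem nextExp_const_mul (c : ℝ) (u : S → ℝ) (s : S) (a : ∀ i, A i) :
    G.nextExp (fun s => c * u s) s a = c * G.nextExp u s a := by
  simp only [nextExp, Finset.mul_sum]
  exact Finset.sum_congr rfl fun _ _ => by ring

theorem policyNext_const_mul (π : JointPolicy N S A) (c : ℝ) (u : S → ℝ) (s : S) :
    G.policyNext π (fun s => c * u s) s = c * G.policyNext π u s := by
  simp only [policyNext, nextExp_const_mul, Finset.mul_sum]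
  exact Finset.sum_congr rfl fun _ _ => by ring

/-- Surviving to time t has probability γ^t, so random stopping replaces discounting. Formally, the
horizon average solves the Bellman equation of the value, whose solution is unique. -/
theorem hasSum_pathExp_reward (i : N) (π : JointPolicy N S A) (s : S) :
    HasSum (fun k : ℕ => (1 - G.discount) * G.discount ^ k *
      G.pathExp π k s (pathSum (G.reward i))) (G.stateValue i s π) := by
  have hs : ∀ s, Summable fun k : ℕ => (1 - G.discount) * G.discount ^ k *
      G.pathExp π k s (pathSum (G.reward i)) := fun s => by
    refine G.summable_horizon_mul _ 1 fun k => ?_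
    refine G.abs_pathExp_le π k s _ _ fun l hl => ?_
    refine (abs_pathSum_le _ 1 (G.abs_reward_le i) l).trans ?_
    rw [hl, mul_one, one_mul]
    push_cast
    exact le_self_pow₀ (by linarith [(Nat.cast_nonneg k : (0 : ℝ) ≤ k)]) (by norm_num)
  set u : S → ℝ := fun s => ∑' k : ℕ, (1 - G.discount) * G.discount ^ k *
      G.pathExp π k s (pathSum (G.reward i)) with hu
  have hu' : ∀ s, HasSum (fun k : ℕ => (1 - G.discount) * G.discount ^ k *
      G.pathExp π k s (pathSum (G.reward i))) (u s) := fun s => (hs s).hasSum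
  rw [← G.eq_stateValue_of_bellman i π u fun s => ?_]
  · exact hu' s
  · have h1 := (hasSum_nat_add_iff' 1).2 (hu' s)
    have h2 := ((G.hasSum_horizon.mul_right (G.meanReward i π s)).add
      (G.hasSum_policyNext π _ u hu' s)).mul_left G.discount
    have e : (fun k : ℕ => (1 - G.discount) * G.discount ^ (k + 1) *
        G.pathExp π (k + 1) s (pathSum (G.reward i))) = fun k : ℕ => G.discount *
        ((1 - G.discount) * G.discount ^ k * G.meanReward i π s + G.policyNext π
          (fun s => (1 - G.discount) * G.discount ^ k *
            G.pathExp π k s (pathSum (G.reward i))) s) := by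
      funext k
      rw [pathExp_pathSum_succ, policyNext_const_mul, meanReward, pow_succ]
      ring
    rw [e] at h1
    have h3 := h1.unique h2
    simp only [Finset.range_one, Finset.sum_singleton, pow_zero, mul_one, pathExp,
      pathSum_singleton] at h3
    have h4 : ∑ a, profileProb π s a * G.reward i s a = G.meanReward i π s := rfl
    rw [h4] at h3
    linarith

/-- The horizon average, as a function of the starting state, solves a Bellman equation. Its source
is the first score times the immediate reward when play stops (weight 1 - γ), or times reward plus
expected future value when it continues (weight γ); together, the first score times the action
value. Flow balance then integrates this source against the visitation measure. -/
theorem hasSum_startExp_mul (i : N) (π : JointPolicy N S A) (h : S → (∀ i, A i) → ℝ)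
    (h0 : ∀ s, ∑ a, profileProb π s a * h s a = 0) :
    HasSum (fun k : ℕ => (1 - G.discount) * G.discount ^ k *
      G.startExp π k fun l => pathSum (G.reward i) l * pathSum h l)
      ((1 - G.discount)⁻¹ * ∑ s, G.visitation π G.init s *
        ∑ a, profileProb π s a * (h s a * G.actionValue i π s a)) := by
  have hp := G.one_sub_discount_pos
  set C : ℝ := ∑ z : S × ∀ i, A i, |h z.1 z.2| with hC
  have hCh : ∀ s a, |h s a| ≤ C := fun s a =>
    Finset.single_le_sum (f := fun z : S × ∀ i, A i => |h z.1 z.2|)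
      (fun _ _ => abs_nonneg _) (Finset.mem_univ (s, a))
  have hC0 : 0 ≤ C := Finset.sum_nonneg fun _ _ => abs_nonneg _
  set U : ℕ → S → ℝ := fun k s => (1 - G.discount) * G.discount ^ k *
    G.pathExp π k s fun l => pathSum (G.reward i) l * pathSum h l with hU
  have hs : ∀ s, Summable fun k : ℕ => U k s := fun s => by
    refine G.summable_horizon_mul _ C fun k => ?_
    refine G.abs_pathExp_le π k s _ _ fun l hl => ?_
    have h1 := abs_pathSum_le _ 1 (G.abs_reward_le i) l
    have h2 := abs_pathSum_le h C hCh l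
    rw [hl] at h1 h2
    push_cast at h1 h2
    rw [abs_mul]
    have hk : (1 : ℝ) ≤ k + 1 := by linarith [(Nat.cast_nonneg k : (0 : ℝ) ≤ k)]
    refine (mul_le_mul h1 h2 (abs_nonneg _) (by positivity)).trans ?_
    have h3 : ((k : ℝ) + 1) ^ 2 ≤ (k + 1) ^ 4 := pow_le_pow_right₀ hk (by norm_num)
    have h4 := mul_le_mul_of_nonneg_left h3 hC0
    linarith
  set u : S → ℝ := fun s => ∑' k : ℕ, U k s with hu
  have hu' : ∀ s, HasSum (fun k : ℕ => U k s) (u s) := fun s => (hs s).hasSum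
  have hb : ∀ s, u s - G.discount * G.policyNext π u s =
      ∑ a, profileProb π s a * (h s a * G.actionValue i π s a) := by
    intro s
    have h1 := (hasSum_nat_add_iff' 1).2 (hu' s)
    have h2 : HasSum (fun k : ℕ => ∑ a, profileProb π s a * (h s a *
        ((1 - G.discount) * G.discount ^ k * G.reward i s a +
          G.nextExp (fun s' => (1 - G.discount) * G.discount ^ k *
            G.pathExp π k s' (pathSum (G.reward i))) s a)))
        (∑ a, profileProb π s a * (h s a * (1 * G.reward i s a +
          G.nextExp (fun s => G.stateValue i s π) s a))) :=
      hasSum_sum fun a _ => (((G.hasSum_horizon.mul_right _).add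
        (G.hasSum_nextExp _ _ (G.hasSum_pathExp_reward i π) s a)).mul_left _).mul_left _
    have h3 := (h2.add (G.hasSum_policyNext π _ u hu' s)).mul_left G.discount
    have e : (fun k : ℕ => U (k + 1) s) = fun k : ℕ => G.discount *
        (∑ a, profileProb π s a * (h s a *
          ((1 - G.discount) * G.discount ^ k * G.reward i s a +
            G.nextExp (fun s' => (1 - G.discount) * G.discount ^ k *
              G.pathExp π k s' (pathSum (G.reward i))) s a)) + G.policyNext π (U k) s) := by
      funext k
      simp only [hU]
      rw [G.pathExp_mul_pathSum_succ π _ h h0, policyNext_const_mul, pow_succ, mul_add, mul_add]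
      congr 1
      · simp only [nextExp_const_mul, Finset.mul_sum]
        exact Finset.sum_congr rfl fun a _ => by ring
      · ring
    rw [e] at h1
    have h4 := h1.unique h3
    simp only [Finset.range_one, Finset.sum_singleton, hU, pow_zero, mul_one, pathExp,
      pathSum_singleton, one_mul] at h4
    have h5 : ∑ a, profileProb π s a * (h s a * G.actionValue i π s a) =
        (1 - G.discount) * ∑ a, profileProb π s a * (G.reward i s a * h s a) +
        G.discount * ∑ a, profileProb π s a * (h s a * (G.reward i s a +
          G.nextExp (fun s => G.stateValue i s π) s a)) := by
      simp only [Finset.mul_sum, ← Finset.sum_add_distrib, actionValue]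
      exact Finset.sum_congr rfl fun a _ => by ring
    rw [h5]
    linarith
  have h6 := G.sum_visitation_sub π G.init u
  simp only [hb] at h6
  rw [h6, inv_mul_cancel_left₀ hp.ne']
  have h7 : HasSum (fun k => ∑ s, (G.init s).toReal * U k s) (∑ s, (G.init s).toReal * u s) :=
    hasSum_sum fun s _ => (hu' s).mul_left _
  convert h7 using 1
  funext k
  simp only [startExp, hU, Finset.mul_sum]
  exact Finset.sum_congr rfl fun s _ => by ring

end Game

/-! ### Projection, and mean and second moment of the gradient estimate. -/

theorem convex_policySet (B : Type*) [Fintype B] : Convex ℝ (policySet S B) := by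
  intro x hx y hy a b ha hb hab
  refine ⟨fun s c => ?_, fun s => ?_⟩
  · simp only [PiLp.add_apply, PiLp.smul_apply, smul_eq_mul]
    exact add_nonneg (mul_nonneg ha (hx.1 s c)) (mul_nonneg hb (hy.1 s c))
  · simp only [PiLp.add_apply, PiLp.smul_apply, smul_eq_mul, Finset.sum_add_distrib,
      ← Finset.mul_sum, hx.2 s, hy.2 s, mul_one, hab]

/-- The variational inequality of the projection makes the angle at the projected point obtuse, so
projecting cannot increase the distance to a feasible point. -/
theorem norm_proj_sub_le {B : Type*} [Fintype B] [Nonempty B] (v : EuclideanSpace ℝ (S × B))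
    (y : Policy S B) : ‖y.1 - (proj v).1‖ ≤ ‖y.1 - v‖ := by
  have hmin : ∀ y : Policy S B, ‖v - (proj v).1‖ ≤ ‖v - y.1‖ := (exists_closest_policy v).choose_spec
  have : Nonempty (policySet S B) := ⟨proj v⟩
  have h1 : ‖v - (proj v).1‖ = ⨅ w : policySet S B, ‖v - w‖ :=
    le_antisymm (le_ciInf hmin)
      (ciInf_le ⟨0, by rintro _ ⟨w, rfl⟩; exact norm_nonneg _⟩ (proj v))
  have h2 := (norm_eq_iInf_iff_real_inner_le_zero (convex_policySet B) (proj v).2).1 h1 y.1 y.2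
  have e : y.1 - v = (y.1 - (proj v).1) - (v - (proj v).1) := by abel
  refine le_of_sq_le_sq ?_ (norm_nonneg _)
  rw [e, norm_sub_sq_real (y.1 - (proj v).1), real_inner_comm (v - (proj v).1) (y.1 - (proj v).1)]
  nlinarith [sq_nonneg ‖v - (proj v).1‖]

theorem div_card_le_greedy {B : Type*} [Fintype B] [Nonempty B] (α : ℝ)
    (hα : α ∈ Set.Icc (0 : ℝ) 1) (x : Policy S B) (z : S × B) :
    α / Fintype.card B ≤ (greedy α hα x).1 z := by
  have h := mul_nonneg (sub_nonneg.2 hα.2) (x.2.1 z.1 z.2)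
  simp only [greedy]
  linarith

open Classical in
theorem gradient_log_greedy {B : Type*} [Fintype B] [Nonempty B] (α : ℝ)
    (hα : α ∈ Set.Icc (0 : ℝ) 1) (hα0 : 0 < α) (x : Policy S B) (z : S × B) :
    gradient (fun y : EuclideanSpace ℝ (S × B) =>
      Real.log ((1 - α) * y z + α / Fintype.card B)) x.1 =
      ((1 - α) / (greedy α hα x).1 z) • EuclideanSpace.single z (1 : ℝ) := by
  have hc : (0 : ℝ) < Fintype.card B := by exact_mod_cast Fintype.card_pos
  have hpos : 0 < (1 - α) * x.1 z + α / Fintype.card B :=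
    (div_pos hα0 hc).trans_le (div_card_le_greedy α hα x z)
  refine HasGradientAt.gradient (hasGradientAt_iff_hasFDerivAt.2 ?_)
  have h1 : HasFDerivAt (fun y : EuclideanSpace ℝ (S × B) => y z)
      (EuclideanSpace.proj z : EuclideanSpace ℝ (S × B) →L[ℝ] ℝ) x.1 :=
    (EuclideanSpace.proj z : EuclideanSpace ℝ (S × B) →L[ℝ] ℝ).hasFDerivAt
  have h2 := ((h1.const_mul (1 - α)).add_const (α / Fintype.card B)).log hpos.ne'
  refine h2.congr_fderiv (ContinuousLinearMap.ext fun v => ?_)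
  simp only [InnerProductSpace.toDual_apply_apply, inner_smul_left, EuclideanSpace.inner_single_left,
    smul_apply, smul_eq_mul, greedy, conj_trivial, one_mul]
  rw [PiLp.proj_apply, div_eq_mul_inv]
  ring

theorem norm_list_sum_sq_le {B E : Type*} [NormedAddCommGroup E] [InnerProductSpace ℝ E]
    (f : B → E) (l : List B) :
    ‖(l.map f).sum‖ ^ 2 ≤ l.length * (l.map fun b => ‖f b‖ ^ 2).sum := by
  induction l with
  | nil => simp
  | cons b l ih =>
    simp only [List.map_cons, List.sum_cons, List.length_cons]
    push_cast
    set T := (l.map f).sum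
    set Q := (l.map fun b => ‖f b‖ ^ 2).sum with hQ
    set n : ℝ := ((l.length : ℕ) : ℝ) with hn
    have hn0 : 0 ≤ n := by positivity
    have hQ0 : 0 ≤ Q := by
      rw [hQ]
      refine List.sum_nonneg fun x hx => ?_
      obtain ⟨c, -, rfl⟩ := List.mem_map.1 hx
      positivity
    have h1 : 2 * inner ℝ (f b) T ≤ n * ‖f b‖ ^ 2 + Q := by
      have h2 := real_inner_le_norm (f b) T
      have h3 : 2 * (‖f b‖ * ‖T‖) ≤ n * ‖f b‖ ^ 2 + Q := by
        refine le_of_sq_le_sq ?_ (by positivity)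
        have h4 := mul_le_mul_of_nonneg_left ih (sq_nonneg ‖f b‖)
        nlinarith [sq_nonneg (n * ‖f b‖ ^ 2 - Q)]
      linarith
    rw [norm_add_sq_real]
    linarith

namespace Game

variable (G : Game N S A)

/-- The derivative of the logarithm of the `α`-greedy policy in direction `v`. -/
def scoreDir [∀ i, Nonempty (A i)] (α : ℝ) (hα : α ∈ Set.Icc (0 : ℝ) 1) (i : N)
    (x : Policy S (A i)) (v : EuclideanSpace ℝ (S × A i)) (s : S) (a : ∀ i, A i) : ℝ :=
  (1 - α) / (greedy α hα x).1 (s, a i) * v (s, a i)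

theorem inner_gradEstimate [∀ i, Nonempty (A i)] (α : ℝ) (hα : α ∈ Set.Icc (0 : ℝ) 1)
    (hα0 : 0 < α) (i : N) (x : Policy S (A i)) (v : EuclideanSpace ℝ (S × A i))
    (l : List (S × ∀ i, A i)) :
    inner ℝ (G.gradEstimate α i x l) v =
      pathSum (G.reward i) l * pathSum (scoreDir α hα i x v) l := by
  classical
  rw [gradEstimate, inner_smul_left, conj_trivial]
  congr 1
  induction l with
  | nil => simp [pathSum]
  | cons z l ih =>
    obtain ⟨s, a⟩ := z
    rw [List.map_cons, List.sum_cons, inner_add_left, ih, pathSum_cons,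
      gradient_log_greedy α hα hα0, inner_smul_left, EuclideanSpace.inner_single_left]
    simp [scoreDir]

/-- Two powers of the length come from the total reward and one from Cauchy–Schwarz on the sum of
scores. -/
theorem norm_gradEstimate_sq_le [∀ i, Nonempty (A i)] (α : ℝ) (hα : α ∈ Set.Icc (0 : ℝ) 1)
    (hα0 : 0 < α) (i : N) (x : Policy S (A i)) (l : List (S × ∀ i, A i)) :
    ‖G.gradEstimate α i x l‖ ^ 2 ≤ (l.length : ℝ) ^ 3 *
      pathSum (fun s a => ((1 - α) / (greedy α hα x).1 (s, a i)) ^ 2) l := by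
  classical
  rw [gradEstimate, norm_smul, mul_pow]
  have h1 := abs_pathSum_le _ 1 (G.abs_reward_le i) l
  have h2 : ‖(l.map fun z => G.reward i z.1 z.2).sum‖ ^ 2 ≤ (l.length : ℝ) ^ 2 := by
    rw [mul_one] at h1
    exact pow_le_pow_left₀ (norm_nonneg _) h1 2
  have h3 := norm_list_sum_sq_le (fun z : S × ∀ i, A i =>
    gradient (fun y : EuclideanSpace ℝ (S × A i) =>
      Real.log ((1 - α) * y (z.1, z.2 i) + α / Fintype.card (A i))) x.1) l
  have h4 : (l.map fun z : S × ∀ i, A i =>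
      ‖gradient (fun y : EuclideanSpace ℝ (S × A i) =>
        Real.log ((1 - α) * y (z.1, z.2 i) + α / Fintype.card (A i))) x.1‖ ^ 2).sum =
      pathSum (fun s a => ((1 - α) / (greedy α hα x).1 (s, a i)) ^ 2) l := by
    rw [pathSum]
    congr 1
    refine List.map_congr_left fun z _ => ?_
    rw [gradient_log_greedy α hα hα0, norm_smul, PiLp.norm_single, norm_one, mul_one,
      Real.norm_eq_abs, sq_abs]
  rw [h4] at h3
  refine (mul_le_mul h2 h3 (by positivity) (by positivity)).trans_eq ?_
  ring

theorem greedy_pos [∀ i, Nonempty (A i)] (α : ℝ) (hα : α ∈ Set.Icc (0 : ℝ) 1) (hα0 : 0 < α)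
    (i : N) (x : Policy S (A i)) (z : S × A i) : 0 < (greedy α hα x).1 z := by
  have hc : (0 : ℝ) < Fintype.card (A i) := by exact_mod_cast Fintype.card_pos
  exact (div_pos hα0 hc).trans_le (div_card_le_greedy α hα x z)

theorem profileProb_mul_scoreDir [∀ i, Nonempty (A i)] (α : ℝ) (hα : α ∈ Set.Icc (0 : ℝ) 1)
    (hα0 : 0 < α) (x : JointPolicy N S A) (i : N) (v : EuclideanSpace ℝ (S × A i)) (s : S)
    (a : ∀ i, A i) :
    profileProb (fun j => greedy α hα (x j)) s a * scoreDir α hα i (x i) v s a =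
      (1 - α) * deviationWeight (fun j => greedy α hα (x j)) i v s a := by
  have h := (greedy_pos α hα hα0 i (x i) (s, a i)).ne'
  rw [profileProb_eq_deviationWeight _ i, deviationWeight, deviationWeight, scoreDir]
  field_simp

theorem hasSum_startExp_inner [∀ i, Nonempty (A i)] (α : ℝ) (hα : α ∈ Set.Icc (0 : ℝ) 1)
    (hα0 : 0 < α) (x : JointPolicy N S A) (i : N) (p q : Policy S (A i)) :
    HasSum (fun k : ℕ => (1 - G.discount) * G.discount ^ k *
      G.startExp (fun j => greedy α hα (x j)) k
        fun l => inner ℝ (G.gradEstimate α i (x i) l) (p.1 - q.1))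
      ((1 - α) * G.policyGradient i (fun j => greedy α hα (x j)) (p.1 - q.1)) := by
  simp only [G.inner_gradEstimate α hα hα0]
  -- A difference of two policies has zero total mass at each state, so the score in this direction
  -- is centred.
  have h0 : ∀ s, ∑ a, profileProb (fun j => greedy α hα (x j)) s a *
      scoreDir α hα i (x i) (p.1 - q.1) s a = 0 := by
    intro s
    simp only [profileProb_mul_scoreDir α hα hα0, ← Finset.mul_sum, deviationWeight_sub,
      Finset.sum_sub_distrib, ← profileProb_update, sum_profileProb, sub_self, mul_zero]
  have h := G.hasSum_startExp_mul i (fun j => greedy α hα (x j)) _ h0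
  have e : (1 - α) * G.policyGradient i (fun j => greedy α hα (x j)) (p.1 - q.1) =
      (1 - G.discount)⁻¹ * ∑ s, G.visitation (fun j => greedy α hα (x j)) G.init s *
        ∑ a, profileProb (fun j => greedy α hα (x j)) s a *
          (scoreDir α hα i (x i) (p.1 - q.1) s a *
            G.actionValue i (fun j => greedy α hα (x j)) s a) := by
    simp only [← mul_assoc, profileProb_mul_scoreDir α hα hα0]
    rw [policyGradient, mul_left_comm, Finset.mul_sum, Finset.mul_sum, Finset.mul_sum]
    refine Finset.sum_congr rfl fun s _ => ?_
    rw [mul_left_comm (1 - α), Finset.mul_sum]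
    congr 2
    exact Finset.sum_congr rfl fun a _ => by ring
  rw [e]
  exact h

/-- One factor of the squared inverse probability cancels against the sampling probability. What is
left is a sum of inverse probabilities of agent `i`, each at most the number of actions over `α` by
exploration. -/
theorem sum_profileProb_score_sq_le [∀ i, Nonempty (A i)] (α : ℝ) (hα : α ∈ Set.Icc (0 : ℝ) 1)
    (hα0 : 0 < α) (x : JointPolicy N S A) (i : N) (s : S) :
    ∑ a, profileProb (fun j => greedy α hα (x j)) s a *
      ((1 - α) / (greedy α hα (x i)).1 (s, a i)) ^ 2 ≤ (maxActions N A : ℝ) ^ 2 / α := by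
  have hc : (0 : ℝ) < Fintype.card (A i) := by exact_mod_cast Fintype.card_pos
  have hcm : (Fintype.card (A i) : ℝ) ≤ maxActions N A := by exact_mod_cast card_le_maxActions i
  set π : JointPolicy N S A := fun j => greedy α hα (x j) with hπ
  set w : EuclideanSpace ℝ (S × A i) := WithLp.toLp 2 fun z => 1 / (greedy α hα (x i)).1 z
    with hw
  have h1 : ∀ a, profileProb π s a * ((1 - α) / (greedy α hα (x i)).1 (s, a i)) ^ 2 ≤
      |deviationWeight π i w s a| := by
    intro a
    have hpos := greedy_pos α hα hα0 i (x i) (s, a i)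
    have hprod : 0 ≤ ∏ j ∈ Finset.univ.erase i, (π j).1 (s, a j) :=
      Finset.prod_nonneg fun j _ => (π j).2.1 s _
    refine le_trans ?_ (le_abs_self _)
    rw [profileProb_eq_deviationWeight π i, deviationWeight, deviationWeight]
    have e : (π i).1 (s, a i) * (∏ j ∈ Finset.univ.erase i, (π j).1 (s, a j)) *
        ((1 - α) / (greedy α hα (x i)).1 (s, a i)) ^ 2 =
        (1 - α) ^ 2 * (w (s, a i) * ∏ j ∈ Finset.univ.erase i, (π j).1 (s, a j)) := by
      simp only [hπ, hw]
      field_simp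
    rw [e]
    refine mul_le_of_le_one_left (mul_nonneg (one_div_nonneg.2 hpos.le) hprod) ?_
    exact pow_le_one₀ (by linarith [hα.2]) (by linarith)
  refine (Finset.sum_le_sum fun a _ => h1 a).trans ?_
  rw [sum_abs_deviationWeight]
  have h2 : ∀ b, |w (s, b)| ≤ Fintype.card (A i) / α := by
    intro b
    have hpos := greedy_pos α hα hα0 i (x i) (s, b)
    have h3 := div_card_le_greedy α hα (x i) (s, b)
    simp only [hw]
    rw [abs_of_pos (by positivity), div_le_div_iff₀ hpos hα0]
    rw [div_le_iff₀ hc] at h3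
    linarith
  refine (Finset.sum_le_sum fun b _ => h2 b).trans ?_
  rw [Finset.sum_const, Finset.card_univ, nsmul_eq_mul, ← mul_div_assoc]
  refine div_le_div_of_nonneg_right ?_ hα0.le
  rw [sq]
  exact mul_le_mul hcm hcm hc.le (by positivity)

theorem pathExp_norm_gradEstimate_sq_le [∀ i, Nonempty (A i)] (α : ℝ)
    (hα : α ∈ Set.Icc (0 : ℝ) 1) (hα0 : 0 < α) (x : JointPolicy N S A) (i : N) (k : ℕ) (s : S) :
    G.pathExp (fun j => greedy α hα (x j)) k s (fun l => ‖G.gradEstimate α i (x i) l‖ ^ 2) ≤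
      (maxActions N A : ℝ) ^ 2 / α * ((k : ℝ) + 1) ^ 4 := by
  refine (G.pathExp_mono _ k s _ (fun l => ((k : ℝ) + 1) ^ 3 *
    pathSum (fun s a => ((1 - α) / (greedy α hα (x i)).1 (s, a i)) ^ 2) l) fun l hl => ?_).trans ?_
  · have h := G.norm_gradEstimate_sq_le α hα hα0 i (x i) l
    rw [hl] at h
    push_cast at h
    exact h
  · rw [pathExp_const_mul]
    have h := G.pathExp_pathSum_le (fun j => greedy α hα (x j)) _ _
      (sum_profileProb_score_sq_le α hα hα0 x i) k s
    refine (mul_le_mul_of_nonneg_left h (by positivity)).trans_eq ?_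
    ring

theorem abs_startExp_le (π : JointPolicy N S A) (k : ℕ) (f : List (S × ∀ i, A i) → ℝ) (M : ℝ)
    (hM : 0 ≤ M) (h : ∀ s, |G.pathExp π k s f| ≤ M) : |G.startExp π k f| ≤ M := by
  have := abs_weighted_sum_le (fun s => (G.init s).toReal) (fun s => G.pathExp π k s f) 1 M
    (by simp only [ENNReal.abs_toReal, sum_toReal_pmf, le_refl]) hM h
  simpa [startExp] using this

theorem exists_hasSum_startExp_norm_sq [∀ i, Nonempty (A i)] (α : ℝ)
    (hα : α ∈ Set.Icc (0 : ℝ) 1) (hα0 : 0 < α) (x : JointPolicy N S A) (i : N) :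
    ∃ M ≤ 24 * (maxActions N A : ℝ) ^ 2 / (α * (1 - G.discount) ^ 4),
      HasSum (fun k : ℕ => (1 - G.discount) * G.discount ^ k *
        G.startExp (fun j => greedy α hα (x j)) k
          fun l => ‖G.gradEstimate α i (x i) l‖ ^ 2) M := by
  have hp := G.one_sub_discount_pos
  have hb : ∀ k : ℕ, |G.startExp (fun j => greedy α hα (x j)) k
      fun l => ‖G.gradEstimate α i (x i) l‖ ^ 2| ≤
        (maxActions N A : ℝ) ^ 2 / α * ((k : ℝ) + 1) ^ 4 := fun k =>
    G.abs_startExp_le _ k _ _ (by positivity) fun s => by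
      have h0 : 0 ≤ G.pathExp (fun j => greedy α hα (x j)) k s
          (fun l => ‖G.gradEstimate α i (x i) l‖ ^ 2) := by
        rw [← G.pathExp_const (fun j => greedy α hα (x j)) k s 0]
        exact G.pathExp_mono _ k s _ _ fun l _ => by positivity
      rw [abs_of_nonneg h0]
      exact G.pathExp_norm_gradEstimate_sq_le α hα hα0 x i k s
  have hs := G.summable_horizon_mul _ _ hb
  refine ⟨_, ?_, hs.hasSum⟩
  have h2 := G.hasSum_horizon_choose.mul_left ((maxActions N A : ℝ) ^ 2 / α)
  refine (hasSum_le (fun k => ?_) hs.hasSum h2).trans_eq ?_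
  · have hw : 0 ≤ (1 - G.discount) * G.discount ^ k :=
      mul_nonneg hp.le (pow_nonneg G.discount_nonneg k)
    rw [mul_left_comm]
    exact mul_le_mul_of_nonneg_left (((le_abs_self _).trans (hb k)).trans
      (mul_le_mul_of_nonneg_left (succ_pow_four_le k) (by positivity))) hw
  · field_simp

theorem startExp_add (π : JointPolicy N S A) (k : ℕ) (f g : List (S × ∀ i, A i) → ℝ) :
    G.startExp π k (fun l => f l + g l) = G.startExp π k f + G.startExp π k g := by
  simp only [startExp, pathExp_add, mul_add, Finset.sum_add_distrib]

theorem startExp_const_mul (π : JointPolicy N S A) (k : ℕ) (c : ℝ)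
    (f : List (S × ∀ i, A i) → ℝ) :
    G.startExp π k (fun l => c * f l) = c * G.startExp π k f := by
  simp only [startExp, pathExp_const_mul, mul_left_comm _ c, Finset.mul_sum]

theorem startExp_const (π : JointPolicy N S A) (k : ℕ) (c : ℝ) :
    G.startExp π k (fun _ => c) = c := by
  simp only [startExp, pathExp_const, ← Finset.sum_mul, sum_toReal_pmf, one_mul]

theorem startExp_sum {B : Type*} (T : Finset B) (π : JointPolicy N S A) (k : ℕ)
    (f : B → List (S × ∀ i, A i) → ℝ) :
    G.startExp π k (fun l => ∑ b ∈ T, f b l) = ∑ b ∈ T, G.startExp π k (f b) := by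
  simp only [startExp, pathExp_sum, Finset.mul_sum]
  exact Finset.sum_comm

/-- The inner product is signed, so the expectation is taken of the whole expression, which is
assumed nonnegative: real series handle it term by term before the passage to `ENNReal`. -/
theorem exists_tsum_trajectoryLaw_quadratic [∀ i, Nonempty (A i)] (α : ℝ)
    (hα : α ∈ Set.Icc (0 : ℝ) 1) (hα0 : 0 < α) (x z : JointPolicy N S A) (c₀ c₁ c₂ : ℝ)
    (hc₂ : 0 ≤ c₂)
    (hf : ∀ l, 0 ≤ c₀ + (c₁ * ∑ i, inner ℝ (G.gradEstimate α i (x i) l) ((z i).1 - (x i).1) +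
      c₂ * ∑ i, ‖G.gradEstimate α i (x i) l‖ ^ 2)) :
    ∃ M, 0 ≤ M ∧ M ≤ c₀ + (c₁ * ∑ i, (1 - α) * G.policyGradient i (fun j => greedy α hα (x j))
        ((z i).1 - (x i).1) +
        c₂ * (Fintype.card N * (24 * (maxActions N A : ℝ) ^ 2 / (α * (1 - G.discount) ^ 4)))) ∧
      ∑' l, G.trajectoryLaw (fun j => greedy α hα (x j)) l * ENNReal.ofReal
        (c₀ + (c₁ * ∑ i, inner ℝ (G.gradEstimate α i (x i) l) ((z i).1 - (x i).1) +
          c₂ * ∑ i, ‖G.gradEstimate α i (x i) l‖ ^ 2)) = ENNReal.ofReal M := by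
  choose m hm hms using G.exists_hasSum_startExp_norm_sq α hα hα0 x
  have h1 := (G.hasSum_horizon.mul_right c₀).add
    (((hasSum_sum fun i (_ : i ∈ Finset.univ) =>
      G.hasSum_startExp_inner α hα hα0 x i (z i) (x i)).mul_left c₁).add
    ((hasSum_sum fun i (_ : i ∈ Finset.univ) => hms i).mul_left c₂))
  have h2 : HasSum (fun k : ℕ => (1 - G.discount) * G.discount ^ k *
      G.startExp (fun j => greedy α hα (x j)) k fun l =>
        c₀ + (c₁ * ∑ i, inner ℝ (G.gradEstimate α i (x i) l) ((z i).1 - (x i).1) +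
          c₂ * ∑ i, ‖G.gradEstimate α i (x i) l‖ ^ 2))
      (1 * c₀ + (c₁ * ∑ i, (1 - α) * G.policyGradient i (fun j => greedy α hα (x j))
        ((z i).1 - (x i).1) + c₂ * ∑ i, m i)) := by
    refine Eq.subst (motive := fun f => HasSum f _) ?_ h1
    funext k
    rw [startExp_add, startExp_add, startExp_const_mul, startExp_const_mul, startExp_const,
      startExp_sum, startExp_sum, ← Finset.mul_sum, ← Finset.mul_sum]
    ring
  refine ⟨_, ?_, ?_, G.tsum_trajectoryLaw _ _ hf _ h2⟩
  · refine h2.nonneg fun k => mul_nonneg (mul_nonneg G.one_sub_discount_pos.le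
      (pow_nonneg G.discount_nonneg k)) ?_
    refine Finset.sum_nonneg fun s _ => mul_nonneg ENNReal.toReal_nonneg ?_
    rw [← G.pathExp_const (fun j => greedy α hα (x j)) k s 0]
    exact G.pathExp_mono _ k s _ _ fun l _ => hf l
  · have h3 : ∑ i, m i ≤
        Fintype.card N * (24 * (maxActions N A : ℝ) ^ 2 / (α * (1 - G.discount) ^ 4)) := by
      refine (Finset.sum_le_sum fun i _ => hm i).trans_eq ?_
      simp
    have h4 := mul_le_mul_of_nonneg_left h3 hc₂
    linarith

end Game

/-! ### The Moreau envelope of the potential and its descent. -/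

/-- The joint parameters as points of a Euclidean space. -/
def paramEmbed (x : JointPolicy N S A) : PiLp 2 fun i => EuclideanSpace ℝ (S × A i) :=
  WithLp.toLp 2 fun i => (x i).1

theorem norm_paramEmbed_sub_sq (x y : JointPolicy N S A) :
    ‖paramEmbed x - paramEmbed y‖ ^ 2 = ∑ i, ‖(x i).1 - (y i).1‖ ^ 2 := by
  rw [PiLp.norm_sq_eq_of_L2]
  rfl

theorem continuous_paramEmbed : Continuous (paramEmbed : JointPolicy N S A → _) := by
  unfold paramEmbed
  fun_prop

theorem exists_paramEmbed_segment (x y : JointPolicy N S A) (t : ℝ) (ht : t ∈ Set.Icc (0 : ℝ) 1) :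
    ∃ z : JointPolicy N S A, paramEmbed z = paramEmbed x + t • (paramEmbed y - paramEmbed x) := by
  refine ⟨fun i => ⟨(x i).1 + t • ((y i).1 - (x i).1),
    (convex_policySet (A i)).add_smul_sub_mem (x i).2 (y i).2 ht⟩, ?_⟩
  rfl

theorem sum_sum_abs_greedy_sub_le [∀ i, Nonempty (A i)] (α : ℝ) (hα : α ∈ Set.Icc (0 : ℝ) 1)
    (x y : JointPolicy N S A) (j : N) (s : S) :
    ∑ b, |(greedy α hα (y j)).1 (s, b) - (greedy α hα (x j)).1 (s, b)| ≤
      √(maxActions N A) * ‖(y j).1 - (x j).1‖ := by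
  refine (sum_abs_le_sqrt_card_mul_norm ((greedy α hα (y j)).1 - (greedy α hα (x j)).1) s).trans ?_
  exact mul_le_mul (Real.sqrt_le_sqrt (by exact_mod_cast card_le_maxActions j))
    (norm_greedy_sub_greedy_le α hα _ _) (norm_nonneg _) (Real.sqrt_nonneg _)

theorem sq_sum_sqrt_mul_norm_le (x y : JointPolicy N S A) :
    (∑ j, √(maxActions N A) * ‖(y j).1 - (x j).1‖) ^ 2 ≤
      Fintype.card N * maxActions N A * ‖paramEmbed y - paramEmbed x‖ ^ 2 := by
  rw [← Finset.mul_sum, mul_pow, Real.sq_sqrt (Nat.cast_nonneg _), norm_paramEmbed_sub_sq]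
  have h : (∑ j, ‖(y j).1 - (x j).1‖) ^ 2 ≤
      Fintype.card N * ∑ j, ‖(y j).1 - (x j).1‖ ^ 2 := by
    simpa using sq_sum_le_card_mul_sum_sq (s := (Finset.univ : Finset N))
      (f := fun j => ‖(y j).1 - (x j).1‖)
  refine (mul_le_mul_of_nonneg_left h (Nat.cast_nonneg _)).trans_eq ?_
  ring

namespace Game

variable (G : Game N S A)

/-- The derivative of the averaged potential in the parameters of the `α`-greedy policies. -/
def paramGradient [∀ i, Nonempty (A i)] (α : ℝ) (hα : α ∈ Set.Icc (0 : ℝ) 1)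
    (x : JointPolicy N S A) (v : PiLp 2 fun i => EuclideanSpace ℝ (S × A i)) : ℝ :=
  ∑ i, (1 - α) * G.policyGradient i (fun j => greedy α hα (x j)) (v i)

/-- A smoothness constant of the averaged potential. -/
def smoothness : ℝ := 4 * Fintype.card N * maxActions N A / (1 - G.discount) ^ 3

theorem paramGradient_smul [∀ i, Nonempty (A i)] (α : ℝ) (hα : α ∈ Set.Icc (0 : ℝ) 1)
    (x : JointPolicy N S A) (v : PiLp 2 fun i => EuclideanSpace ℝ (S × A i)) (t : ℝ) :
    G.paramGradient α hα x (t • v) = t * G.paramGradient α hα x v := by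
  simp only [paramGradient, PiLp.smul_apply, policyGradient_smul, Finset.mul_sum]
  exact Finset.sum_congr rfl fun i _ => by ring

theorem paramGradient_sub [∀ i, Nonempty (A i)] (α : ℝ) (hα : α ∈ Set.Icc (0 : ℝ) 1)
    (x y z : JointPolicy N S A) :
    G.paramGradient α hα x (paramEmbed y - paramEmbed z) =
      ∑ i, G.policyGradient i (fun j => greedy α hα (x j))
        ((greedy α hα (y i)).1 - (greedy α hα (z i)).1) := by
  simp only [greedy_sub_greedy, policyGradient_smul]
  rfl

variable {G}

/-- Cauchy–Schwarz over actions and over agents converts the L¹ expansion into a Euclidean one, at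
the cost of the factors A_max and n in the smoothness constant. -/
theorem IsPotential.abs_sub_sub_paramGradient_le [∀ i, Nonempty (A i)]
    {Φ : S → JointPolicy N S A → ℝ} (hΦ : G.IsPotential Φ) (α : ℝ)
    (hα : α ∈ Set.Icc (0 : ℝ) 1) (x y : JointPolicy N S A) :
    |G.meanPotential Φ (fun j => greedy α hα (y j)) -
      G.meanPotential Φ (fun j => greedy α hα (x j)) -
      G.paramGradient α hα x (paramEmbed y - paramEmbed x)| ≤
        G.smoothness / 2 * ‖paramEmbed y - paramEmbed x‖ ^ 2 := by
  have hp := G.one_sub_discount_pos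
  have h := hΦ.abs_meanPotential_sub_sub_le (fun j => greedy α hα (x j))
    (fun j => greedy α hα (y j)) _ (sum_sum_abs_greedy_sub_le α hα x y)
  rw [paramGradient_sub]
  refine h.trans ?_
  have h2 := sq_sum_sqrt_mul_norm_le x y
  rw [smoothness, div_div, div_mul_eq_mul_div, div_le_div_iff₀ (by positivity) (by positivity)]
  have h3 := mul_le_mul_of_nonneg_right h2 (by positivity : 0 ≤ 4 * (1 - G.discount) ^ 3)
  linarith

theorem IsPotential.continuous_meanPotential_greedy [∀ i, Nonempty (A i)]
    {Φ : S → JointPolicy N S A → ℝ} (hΦ : G.IsPotential Φ) (α : ℝ)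
    (hα : α ∈ Set.Icc (0 : ℝ) 1) :
    Continuous fun x : JointPolicy N S A => G.meanPotential Φ fun j => greedy α hα (x j) := by
  rw [continuous_iff_continuousAt]
  intro x
  rw [ContinuousAt, tendsto_iff_dist_tendsto_zero]
  set e : JointPolicy N S A → ℝ := fun y => ∑ j, √(maxActions N A) * ‖(y j).1 - (x j).1‖ with he
  have hc : Continuous fun y => e y / (1 - G.discount) ^ 2 +
      2 * e y ^ 2 / (1 - G.discount) ^ 3 := by
    simp only [he]
    fun_prop
  have ht := hc.tendsto x
  have hx : e x = 0 := by simp [he]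
  simp only [hx] at ht
  norm_num at ht
  refine squeeze_zero (fun _ => dist_nonneg) (fun y => ?_) ht
  rw [Real.dist_eq]
  exact hΦ.abs_meanPotential_sub_le (fun j => greedy α hα (x j))
    (fun j => greedy α hα (y j)) _ (sum_sum_abs_greedy_sub_le α hα x y)

theorem IsPotential.exists_proximal_parameter [∀ i, Nonempty (A i)]
    {Φ : S → JointPolicy N S A → ℝ} (hΦ : G.IsPotential Φ) (α : ℝ)
    (hα : α ∈ Set.Icc (0 : ℝ) 1) (x : JointPolicy N S A) :
    ∃ z : JointPolicy N S A,
      (∀ y, G.meanPotential Φ (fun j => greedy α hα (y j)) -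
          G.smoothness * ‖paramEmbed y - paramEmbed x‖ ^ 2 ≤
        G.meanPotential Φ (fun j => greedy α hα (z j)) -
          G.smoothness * ‖paramEmbed z - paramEmbed x‖ ^ 2) ∧
      (∀ y, G.paramGradient α hα z (paramEmbed y - paramEmbed z) ≤
        2 * G.smoothness * inner ℝ (paramEmbed z - paramEmbed x) (paramEmbed y - paramEmbed z)) ∧
      G.smoothness * ‖paramEmbed z - paramEmbed x‖ ^ 2 ≤
        G.paramGradient α hα x (paramEmbed z - paramEmbed x) :=
  exists_proximal_point paramEmbed continuous_paramEmbed exists_paramEmbed_segment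
    (fun y => G.meanPotential Φ fun j => greedy α hα (y j))
    (hΦ.continuous_meanPotential_greedy α hα) (G.paramGradient α hα)
    (G.paramGradient_smul α hα) G.smoothness (hΦ.abs_sub_sub_paramGradient_le α hα) x

theorem norm_paramEmbed_sub_step_sq_le [∀ i, Nonempty (A i)] (α η : ℝ) (x z : JointPolicy N S A)
    (l : List (S × ∀ i, A i)) :
    ‖paramEmbed z - paramEmbed (G.step α η x l)‖ ^ 2 ≤ ‖paramEmbed z - paramEmbed x‖ ^ 2 +
      (-(2 * η) * ∑ i, inner ℝ (G.gradEstimate α i (x i) l) ((z i).1 - (x i).1) +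
        η ^ 2 * ∑ i, ‖G.gradEstimate α i (x i) l‖ ^ 2) := by
  rw [norm_paramEmbed_sub_sq, norm_paramEmbed_sub_sq, Finset.mul_sum, Finset.mul_sum,
    ← Finset.sum_add_distrib, ← Finset.sum_add_distrib]
  refine Finset.sum_le_sum fun i _ => ?_
  have h := norm_proj_sub_le ((x i).1 + η • G.gradEstimate α i (x i) l) (z i)
  refine (pow_le_pow_left₀ (norm_nonneg _) h 2).trans_eq ?_
  rw [← sub_sub, norm_sub_sq_real, inner_smul_right, norm_smul, mul_pow, Real.norm_eq_abs, sq_abs,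
    real_inner_comm ((z i).1 - (x i).1)]
  ring

/-- `φ` is a constant minus the Moreau envelope. The projected step approaches `Z x` on average at
the rate of the slope towards `Z x`, which `hgrad` bounds below by β‖Z x - x‖²; the second moment of
the estimate gives the η² error. -/
theorem tsum_step_add_le [∀ i, Nonempty (A i)] {Φ : S → JointPolicy N S A → ℝ} (α : ℝ)
    (hα : α ∈ Set.Icc (0 : ℝ) 1) (hα0 : 0 < α) (η : ℝ) (hη : 0 ≤ η)
    (Z : JointPolicy N S A → JointPolicy N S A)
    (hmax : ∀ x y, G.meanPotential Φ (fun j => greedy α hα (y j)) -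
          G.smoothness * ‖paramEmbed y - paramEmbed x‖ ^ 2 ≤
        G.meanPotential Φ (fun j => greedy α hα (Z x j)) -
          G.smoothness * ‖paramEmbed (Z x) - paramEmbed x‖ ^ 2)
    (hgrad : ∀ x, G.smoothness * ‖paramEmbed (Z x) - paramEmbed x‖ ^ 2 ≤
        G.paramGradient α hα x (paramEmbed (Z x) - paramEmbed x)) (C : ℝ)
    (hC : ∀ x : JointPolicy N S A, G.meanPotential Φ (fun j => greedy α hα (x j)) ≤ C)
    (φ : JointPolicy N S A → ℝ)
    (hφ : ∀ x, φ x = C - G.meanPotential Φ (fun j => greedy α hα (Z x j)) +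
      G.smoothness * ‖paramEmbed (Z x) - paramEmbed x‖ ^ 2) (x : JointPolicy N S A) :
    ∑' l, G.trajectoryLaw (fun j => greedy α hα (x j)) l *
        ENNReal.ofReal (φ (G.step α η x l)) +
      ENNReal.ofReal (2 * G.smoothness ^ 2 * η) *
        ENNReal.ofReal (‖paramEmbed (Z x) - paramEmbed x‖ ^ 2) ≤
    ENNReal.ofReal (φ x) + ENNReal.ofReal (G.smoothness * η ^ 2 *
      (Fintype.card N * (24 * (maxActions N A : ℝ) ^ 2 / (α * (1 - G.discount) ^ 4)))) := by
  have hp := G.one_sub_discount_pos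
  have hβ : 0 ≤ G.smoothness := by
    unfold smoothness
    positivity
  have hφ0 : ∀ x, 0 ≤ φ x := fun x => by
    rw [hφ]
    have := mul_nonneg hβ (sq_nonneg ‖paramEmbed (Z x) - paramEmbed x‖)
    linarith [hC (Z x)]
  set σ : ℝ := Fintype.card N * (24 * (maxActions N A : ℝ) ^ 2 / (α * (1 - G.discount) ^ 4))
    with hσ
  have hσ0 : 0 ≤ σ := by positivity
  have hstep : ∀ l, φ (G.step α η x l) ≤ φ x +
      (-(2 * G.smoothness * η) *
        ∑ i, inner ℝ (G.gradEstimate α i (x i) l) ((Z x i).1 - (x i).1) +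
      (G.smoothness * η ^ 2) * ∑ i, ‖G.gradEstimate α i (x i) l‖ ^ 2) := fun l => by
    -- The old proximal point `Z x` serves as competitor in the maximisation defining the envelope
    -- at the new iterate.
    have h1 := hmax (G.step α η x l) (Z x)
    have h2 := mul_le_mul_of_nonneg_left
      (norm_paramEmbed_sub_step_sq_le (G := G) α η x (Z x) l) hβ
    rw [hφ, hφ]
    linarith
  obtain ⟨M, hM0, hM, hMs⟩ := G.exists_tsum_trajectoryLaw_quadratic α hα hα0 x (Z x) (φ x)
    (-(2 * G.smoothness * η)) (G.smoothness * η ^ 2) (by positivity)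
    fun l => (hφ0 _).trans (hstep l)
  have h1 : ∑' l, G.trajectoryLaw (fun j => greedy α hα (x j)) l *
      ENNReal.ofReal (φ (G.step α η x l)) ≤ ENNReal.ofReal M := by
    rw [← hMs]
    exact ENNReal.tsum_le_tsum fun l => mul_le_mul_right (ENNReal.ofReal_le_ofReal (hstep l)) _
  refine (add_le_add_left h1 _).trans ?_
  rw [← ENNReal.ofReal_mul (by positivity), ← ENNReal.ofReal_add hM0 (by positivity),
    ← ENNReal.ofReal_add (hφ0 x) (by positivity)]
  refine ENNReal.ofReal_le_ofReal ?_
  have h2 : ∑ i, (1 - α) * G.policyGradient i (fun j => greedy α hα (x j))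
      ((Z x i).1 - (x i).1) = G.paramGradient α hα x (paramEmbed (Z x) - paramEmbed x) := rfl
  rw [h2] at hM
  have h3 := mul_le_mul_of_nonneg_left (hgrad x) (by positivity : 0 ≤ 2 * G.smoothness * η)
  linarith

/-- Testing the optimality of `z` with a change of one agent isolates that agent's gradient. Its
size is at most 2β times the displacement times the diameter 2√S of a policy set. -/
theorem nashGap_greedy_le_of_proximal [∀ i, Nonempty (A i)] {I : Set (PMF S)} (hI : I.Nonempty)
    (hD : ∀ ν ∈ I, ∀ (π : JointPolicy N S A) (s : S), G.init s = 0 → G.visitation π ν s = 0)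
    (α : ℝ) (hα : α ∈ Set.Icc (0 : ℝ) 1) (x z : JointPolicy N S A)
    (hopt : ∀ y, G.paramGradient α hα z (paramEmbed y - paramEmbed z) ≤
        2 * G.smoothness * inner ℝ (paramEmbed z - paramEmbed x) (paramEmbed y - paramEmbed z)) :
    G.nashGap I (fun j => greedy α hα (x j)) ≤ 2 * α / (1 - G.discount) ^ 2 +
      (4 * G.mismatch I * G.smoothness * √(Fintype.card S) / (1 - G.discount) +
        2 * √(Fintype.card N * maxActions N A) / (1 - G.discount) ^ 2) *
        ‖paramEmbed z - paramEmbed x‖ := by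
  have hp := G.one_sub_discount_pos
  have hβ : 0 ≤ G.smoothness := by
    unfold smoothness
    positivity
  set δ := ‖paramEmbed z - paramEmbed x‖ with hδ
  have h := nashGap_greedy_le hI hD α hα x z (4 * G.smoothness * √(Fintype.card S) * δ)
    (√(Fintype.card N * maxActions N A) * δ) (by positivity) ?_ ?_
  · refine h.trans_eq ?_
    ring
  · intro i y
    have h1 := hopt (Function.update z i y)
    rw [paramGradient_sub, Finset.sum_eq_single i] at h1
    rotate_left
    · intro j _ hj
      rw [Function.update_of_ne hj, sub_self, policyGradient_zero]
    · simp
    rw [Function.update_self] at h1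
    have h2 := real_inner_le_norm (paramEmbed z - paramEmbed x)
      (paramEmbed (Function.update z i y) - paramEmbed z)
    have h3 : ‖paramEmbed (Function.update z i y) - paramEmbed z‖ ≤ 2 * √(Fintype.card S) := by
      refine le_of_sq_le_sq ?_ (by positivity)
      rw [norm_paramEmbed_sub_sq, Finset.sum_eq_single i]
      · rw [Function.update_self, mul_pow, Real.sq_sqrt (Nat.cast_nonneg _)]
        exact (norm_policy_sub_sq_le y (z i)).trans_eq (by norm_num)
      · intro j _ hj
        simp [Function.update_of_ne hj]
      · simp
    have h4 := h2.trans (mul_le_mul_of_nonneg_left h3 (norm_nonneg _))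
    have h5 := mul_le_mul_of_nonneg_left h4 (by positivity : 0 ≤ 2 * G.smoothness)
    refine h1.trans (h5.trans_eq ?_)
    ring
  · intro s
    refine (Finset.sum_le_sum fun j _ => sum_sum_abs_greedy_sub_le α hα z x j s).trans ?_
    refine le_of_sq_le_sq ?_ (by positivity)
    rw [mul_pow, Real.sq_sqrt (by positivity), hδ, norm_sub_rev]
    exact sq_sum_sqrt_mul_norm_le z x

end Game

/-! ### Telescoping, constants and the final estimate. -/

/-- Telescope from time 1, then compare the minimum with the average. In `ENNReal` no summability or
finiteness of `a` and `e` has to be known. -/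
theorem exists_le_of_descent (a e : ℕ → ENNReal) (c b R : ℝ) (hb : 0 ≤ b) (hR : 0 ≤ R)
    (h : ∀ t, a (t + 1) + ENNReal.ofReal c * e t ≤ a t + ENNReal.ofReal b)
    (ha : a 1 ≤ ENNReal.ofReal R) (T : ℕ) (hT : 1 ≤ T) :
    ∃ t ∈ Finset.Icc 1 T, ENNReal.ofReal c * e t ≤ ENNReal.ofReal (R / T + b) := by
  have hs : ∀ T : ℕ, a (T + 1) + ∑ t ∈ Finset.Icc 1 T, ENNReal.ofReal c * e t ≤
      ENNReal.ofReal R + T * ENNReal.ofReal b := by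
    intro T
    induction T with
    | zero => simpa using ha
    | succ T ih =>
      rw [Finset.sum_Icc_succ_top (by omega)]
      calc a (T + 1 + 1) + (∑ t ∈ Finset.Icc 1 T, ENNReal.ofReal c * e t +
            ENNReal.ofReal c * e (T + 1))
          = (a (T + 1 + 1) + ENNReal.ofReal c * e (T + 1)) +
            ∑ t ∈ Finset.Icc 1 T, ENNReal.ofReal c * e t := by ring
        _ ≤ (a (T + 1) + ENNReal.ofReal b) + ∑ t ∈ Finset.Icc 1 T, ENNReal.ofReal c * e t :=
            add_le_add_left (h _) _
        _ = (a (T + 1) + ∑ t ∈ Finset.Icc 1 T, ENNReal.ofReal c * e t) + ENNReal.ofReal b := by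
            ring
        _ ≤ (ENNReal.ofReal R + T * ENNReal.ofReal b) + ENNReal.ofReal b := add_le_add_left ih _
        _ = ENNReal.ofReal R + (T + 1 : ℕ) * ENNReal.ofReal b := by
            push_cast
            ring
  have hT0 : (0 : ℝ) < T := by exact_mod_cast hT
  by_contra! hcon
  have h1 := ENNReal.sum_lt_sum_of_nonempty (Finset.nonempty_Icc.2 hT) hcon
  have h2 := h1.trans_le (le_add_self.trans (hs T))
  rw [Finset.sum_const, Nat.card_Icc, Nat.add_sub_cancel, nsmul_eq_mul,
    ← ENNReal.ofReal_natCast, ← ENNReal.ofReal_mul hT0.le, ← ENNReal.ofReal_mul hT0.le,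
    ← ENNReal.ofReal_add hR (by positivity)] at h2
  refine h2.ne ?_
  congr 1
  field_simp

theorem stepSize_bound (g ε n a s D R T η β B : ℝ) (hg : 0 < g) (hg1 : g ≤ 1) (hε : 0 < ε)
    (hn : 1 ≤ n) (ha : 1 ≤ a) (hs : 1 ≤ s) (hD : 1 ≤ D) (hR : 0 ≤ R)
    (hT : 0 < T)
    (hTR : 10 ^ 8 * n ^ 2 * a ^ 3 * R * D ^ 4 * s ^ 2 / (g ^ 11 * ε ^ 6) ≤ T)
    (hη : η = ε ^ 4 * g ^ 9 / (10 ^ 5 * n ^ 2 * a ^ 3 * D ^ 2 * s)) (hβ : β = 4 * n * a / g ^ 3)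
    (hB : B = 4 * D * β * √s / g + 2 * √(n * a) / g ^ 2) :
    B ^ 2 / ε * ((R / T + β * η ^ 2 * (n * (24 * a ^ 2 / (ε ^ 2 * g ^ 4)))) / (2 * β ^ 2 * η)) ≤
      ε / 4 := by
  have hn0 : 0 < n := by linarith
  have ha0 : 0 < a := by linarith
  have hs0 : 0 < s := by linarith
  have hD0 : 0 < D := by linarith
  have hη0 : 0 < η := by rw [hη]; positivity
  have hβ0 : 0 < β := by rw [hβ]; positivity
  -- 18 = 16 + 2: the first term of `B` carries 4 · 4 from the smoothness constant, and the second
  -- is enlarged to the same shape. The square 324 enters below.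
  have hB1 : B ≤ 18 * n * a * √s * D / g ^ 4 := by
    have h1 : √(n * a) ≤ n * a * √s * D := by
      have hna : 1 ≤ n * a := one_le_mul_of_one_le_of_one_le hn ha
      have h2 : √(n * a) ≤ n * a :=
        Real.sqrt_le_iff.2 ⟨by positivity, le_self_pow₀ hna (by norm_num)⟩
      have h3 : 1 ≤ √s := Real.one_le_sqrt.2 hs
      have h4 : n * a * 1 ≤ n * a * (√s * D) :=
        mul_le_mul_of_nonneg_left (one_le_mul_of_one_le_of_one_le h3 hD) (by positivity)
      linarith
    have h2 : 2 * √(n * a) / g ^ 2 ≤ 2 * (n * a * √s * D) / g ^ 4 := by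
      have : g ^ 4 ≤ g ^ 2 := pow_le_pow_of_le_one hg.le hg1 (by norm_num)
      gcongr
    have h3 : 4 * D * β * √s / g = 16 * n * a * √s * D / g ^ 4 := by
      rw [hβ]
      field_simp
      ring
    rw [hB, h3]
    refine (add_le_add_right h2 _).trans_eq ?_
    ring
  have hB0 : 0 ≤ B := by rw [hB]; positivity
  have hB2 : B ^ 2 ≤ 324 * n ^ 2 * a ^ 2 * s * D ^ 2 / g ^ 8 := by
    refine (pow_le_pow_left₀ hB0 hB1 2).trans_eq ?_
    rw [div_pow, mul_pow, mul_pow, Real.sq_sqrt hs0.le]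
    ring
  have hRT : R / T ≤ g ^ 11 * ε ^ 6 / (10 ^ 8 * n ^ 2 * a ^ 3 * D ^ 4 * s ^ 2) := by
    rw [div_le_iff₀ (by positivity)] at hTR
    rw [div_le_div_iff₀ hT (by positivity)]
    linarith
  calc B ^ 2 / ε *
        ((R / T + β * η ^ 2 * (n * (24 * a ^ 2 / (ε ^ 2 * g ^ 4)))) / (2 * β ^ 2 * η))
      ≤ (324 * n ^ 2 * a ^ 2 * s * D ^ 2 / g ^ 8) / ε *
        ((g ^ 11 * ε ^ 6 / (10 ^ 8 * n ^ 2 * a ^ 3 * D ^ 4 * s ^ 2) +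
          β * η ^ 2 * (n * (24 * a ^ 2 / (ε ^ 2 * g ^ 4)))) / (2 * β ^ 2 * η)) := by
        refine mul_le_mul (div_le_div_of_nonneg_right hB2 hε.le)
          (div_le_div_of_nonneg_right (add_le_add_left hRT _) (by positivity)) (by positivity)
          (by positivity)
    -- The two numbers are the telescoping share and the variance share; all game parameters cancel
    -- by the choice of step size and horizon.
    _ = (324 / 32 / 10 ^ 3 + 324 * 3 / 10 ^ 5) * ε := by
        rw [hβ, hη]
        field_simp
        ring
    _ ≤ ε / 4 := by linarith

end

end MarkovGame

open MarkovGame in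
theorem mainTheorem2 {N S : Type*} {A : N → Type*} [Fintype N] [DecidableEq N] [Nonempty N]
    [Fintype S] [∀ i, Fintype (A i)] [∀ i, Nonempty (A i)]
    (G : MarkovGame.Game N S A) (Φ : S → MarkovGame.JointPolicy N S A → ℝ)
    (hΦ : G.IsPotential Φ)
    (I : Set (PMF S)) (hI : I.Nonempty)
    (hD : ∀ ν ∈ I, ∀ (π : MarkovGame.JointPolicy N S A) (s : S),
      G.init s = 0 → G.visitation π ν s = 0)
    (ε : ℝ) (hε : 0 < ε) (hε' : ε ≤ (1 - G.discount) ^ 2 / 4)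
    (α : ℝ) (hα : α ∈ Set.Icc (0 : ℝ) 1) (hαε : α = ε ^ 2)
    (η : ℝ) (hη : η = MarkovGame.stepSize ε G.discount (G.mismatch I)
      (Fintype.card N) (MarkovGame.maxActions N A) (Fintype.card S))
    (T : ℕ) (hT : T = MarkovGame.iterations ε G.discount (G.mismatch I) (G.potentialRange Φ)
      (Fintype.card N) (MarkovGame.maxActions N A) (Fintype.card S))
    (x₀ : MarkovGame.JointPolicy N S A) :
    ∃ t ∈ Finset.Icc 1 T,
      ∑' x : MarkovGame.JointPolicy N S A, G.iterateLaw α hα η x₀ t x *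
        ENNReal.ofReal (G.nashGap I fun i => MarkovGame.greedy α hα (x i)) ≤ ENNReal.ofReal ε := by
  have hp := G.one_sub_discount_pos
  have hα0 : 0 < α := by rw [hαε]; positivity
  have hn : (1 : ℝ) ≤ Fintype.card N := by exact_mod_cast Fintype.card_pos
  have ha : (1 : ℝ) ≤ maxActions N A := by
    obtain ⟨i⟩ := ‹Nonempty N›
    exact_mod_cast Fintype.card_pos.trans_le (card_le_maxActions (A := A) i)
  have hs : (1 : ℝ) ≤ Fintype.card S := by
    obtain ⟨s₀, -⟩ := G.init.support_nonempty
    exact_mod_cast Fintype.card_pos_iff.2 ⟨s₀⟩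
  have hD1 : 1 ≤ G.mismatch I := Game.one_le_mismatch hI hD
  have hβ0 : 0 < G.smoothness := by
    unfold Game.smoothness
    positivity
  have hη0 : 0 < η := by
    rw [hη, stepSize]
    positivity
  have hT1 : 1 ≤ T := by
    rw [hT, iterations]
    exact le_max_left _ _
  have hT0 : (0 : ℝ) < T := by exact_mod_cast hT1
  have hTR : 10 ^ 8 * (Fintype.card N : ℝ) ^ 2 * (maxActions N A : ℝ) ^ 3 * G.potentialRange Φ *
      G.mismatch I ^ 4 * (Fintype.card S : ℝ) ^ 2 / ((1 - G.discount) ^ 11 * ε ^ 6) ≤ T := by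
    rw [hT, iterations]
    exact (Nat.le_ceil _).trans (by exact_mod_cast le_max_right _ _)
  have hR : 0 ≤ G.potentialRange Φ := by
    simpa using hΦ.meanPotential_sub_le_potentialRange x₀ x₀
  choose Z hmax hopt hgrad using hΦ.exists_proximal_parameter α hα
  obtain ⟨m, -, hm⟩ := isCompact_univ.exists_isMaxOn
    (f := fun x : JointPolicy N S A => G.meanPotential Φ fun j => greedy α hα (x j))
    ⟨x₀, Set.mem_univ x₀⟩ (hΦ.continuous_meanPotential_greedy α hα).continuousOn
  set φ : JointPolicy N S A → ℝ := fun x => G.meanPotential Φ (fun j => greedy α hα (m j)) -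
    G.meanPotential Φ (fun j => greedy α hα (Z x j)) +
      G.smoothness * ‖paramEmbed (Z x) - paramEmbed x‖ ^ 2 with hφ
  set b : ℝ := G.smoothness * η ^ 2 * (Fintype.card N *
    (24 * (maxActions N A : ℝ) ^ 2 / (α * (1 - G.discount) ^ 4))) with hb
  have hb0 : 0 ≤ b := by positivity
  set c : ℝ := 2 * G.smoothness ^ 2 * η with hc
  have hc0 : 0 < c := by positivity
  set δ : JointPolicy N S A → ℝ := fun x => ‖paramEmbed (Z x) - paramEmbed x‖ with hδ
  have hφR : ∀ x, φ x ≤ G.potentialRange Φ := fun x => by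
    -- With `x` as its own competitor the penalty vanishes, so the envelope lies above F and `φ` is
    -- at most the range of the potential at every parameter, in particular after the first step.
    have h1 := hmax x x
    have h2 := hΦ.meanPotential_sub_le_potentialRange (fun j => greedy α hα (m j))
      (fun j => greedy α hα (x j))
    simp only [sub_self, norm_zero] at h1
    simp only [hφ]
    linarith
  obtain ⟨t, ht, hle⟩ := exists_le_of_descent
    (fun t => ∑' x, G.iterateLaw α hα η x₀ t x * ENNReal.ofReal (φ x))
    (fun t => ∑' x, G.iterateLaw α hα η x₀ t x * ENNReal.ofReal (δ x ^ 2)) c b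
    (G.potentialRange Φ) hb0 hR (fun t => by
      have h := fun x => Game.tsum_step_add_le α hα hα0 η hη0.le Z hmax hgrad
        (G.meanPotential Φ fun j => greedy α hα (m j)) (fun x => hm (Set.mem_univ x)) φ
        (fun x => rfl) x
      simp only [Game.iterateLaw, tsum_bind_mul, tsum_map_mul]
      rw [← ENNReal.tsum_mul_left, ← ENNReal.tsum_add]
      calc _ ≤ ∑' x, G.iterateLaw α hα η x₀ t x * (ENNReal.ofReal (φ x) + ENNReal.ofReal b) := by
            refine ENNReal.tsum_le_tsum fun x => ?_
            rw [mul_left_comm, ← mul_add]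
            exact mul_le_mul_right (h x) _
        _ = _ := by
            simp only [mul_add]
            rw [ENNReal.tsum_add, ENNReal.tsum_mul_right, PMF.tsum_coe, one_mul]) (by
      calc _ ≤ ∑' x, G.iterateLaw α hα η x₀ 1 x * ENNReal.ofReal (G.potentialRange Φ) :=
            ENNReal.tsum_le_tsum fun x =>
              mul_le_mul_right (ENNReal.ofReal_le_ofReal (hφR x)) _
        _ = _ := by rw [ENNReal.tsum_mul_right, PMF.tsum_coe, one_mul]) T hT1
  refine ⟨t, ht, ?_⟩
  set B : ℝ := 4 * G.mismatch I * G.smoothness * √(Fintype.card S) / (1 - G.discount) +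
    2 * √(Fintype.card N * maxActions N A) / (1 - G.discount) ^ 2 with hB
  -- The exploration cost is at most ε / 2 by the bound on ε. The term linear in δ is split by the
  -- arithmetic–geometric mean inequality, so that control of the expectation of δ² suffices without
  -- Jensen's inequality.
  have hgap : ∀ x, G.nashGap I (fun i => greedy α hα (x i)) ≤
      3 * ε / 4 + B ^ 2 / ε * δ x ^ 2 := fun x => by
    have h1 := Game.nashGap_greedy_le_of_proximal hI hD α hα x (Z x) (hopt x)
    have h2 : 2 * α / (1 - G.discount) ^ 2 ≤ ε / 2 := by
      rw [hαε, div_le_iff₀ (by positivity)]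
      have := mul_le_mul_of_nonneg_left hε' hε.le
      linarith
    have h3 : B * δ x ≤ ε / 4 + B ^ 2 / ε * δ x ^ 2 := by
      have e : ε / 4 + B ^ 2 / ε * δ x ^ 2 - B * δ x = (ε / 2 - B * δ x) ^ 2 / ε := by
        field_simp
        ring
      have : 0 ≤ (ε / 2 - B * δ x) ^ 2 / ε := by positivity
      linarith
    change _ ≤ _ + B * δ x at h1
    linarith
  have hle' : ∑' x, G.iterateLaw α hα η x₀ t x * ENNReal.ofReal (δ x ^ 2) ≤
      ENNReal.ofReal ((G.potentialRange Φ / T + b) / c) := by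
    rw [ENNReal.ofReal_div_of_pos hc0, ENNReal.le_div_iff_mul_le (Or.inl (by simpa using hc0))
      (Or.inl ENNReal.ofReal_ne_top), mul_comm]
    exact hle
  have hnum := stepSize_bound (1 - G.discount) ε (Fintype.card N) (maxActions N A)
    (Fintype.card S) (G.mismatch I) (G.potentialRange Φ) T η G.smoothness B hp
    (by linarith [G.discount_nonneg]) hε hn ha hs hD1 hR hT0 hTR (by rw [hη, stepSize]) rfl hB
  rw [← hαε] at hnum
  calc ∑' x, G.iterateLaw α hα η x₀ t x *
        ENNReal.ofReal (G.nashGap I fun i => greedy α hα (x i))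
      ≤ ∑' x, (G.iterateLaw α hα η x₀ t x * ENNReal.ofReal (3 * ε / 4) +
          G.iterateLaw α hα η x₀ t x * ENNReal.ofReal (δ x ^ 2) * ENNReal.ofReal (B ^ 2 / ε)) := by
        refine ENNReal.tsum_le_tsum fun x => ?_
        rw [mul_assoc, ← ENNReal.ofReal_mul (by positivity), ← mul_add,
          ← ENNReal.ofReal_add (by positivity) (by positivity)]
        refine mul_le_mul_right (ENNReal.ofReal_le_ofReal ((hgap x).trans_eq ?_)) _
        ring
    _ = ENNReal.ofReal (3 * ε / 4) +
        (∑' x, G.iterateLaw α hα η x₀ t x * ENNReal.ofReal (δ x ^ 2)) *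
          ENNReal.ofReal (B ^ 2 / ε) := by
        rw [ENNReal.tsum_add, ENNReal.tsum_mul_right, ENNReal.tsum_mul_right, PMF.tsum_coe, one_mul]
    _ ≤ ENNReal.ofReal (3 * ε / 4) + ENNReal.ofReal ((G.potentialRange Φ / T + b) / c) *
          ENNReal.ofReal (B ^ 2 / ε) := by gcongr
    _ = ENNReal.ofReal (3 * ε / 4 + B ^ 2 / ε * ((G.potentialRange Φ / T + b) / c)) := by
        rw [← ENNReal.ofReal_mul (by positivity), ← ENNReal.ofReal_add (by positivity)
          (by positivity), mul_comm (B ^ 2 / ε)]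
    _ ≤ ENNReal.ofReal ε := ENNReal.ofReal_le_ofReal (by linarith)
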